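/- Let $p$ be a prime, $\Bbbk$ a field of characteristic $p$ and $a\in\mathbb{F}_p$. Let $\mathrm{Sym}_2\subset \mathrm{Pol}_2=\Bbbk[x_1,x_2]$ be the ring of symmetric polynomials, and let $\mathrm{Sym}_2'\subset\mathrm{Sym}_2$ be the ideal of those with zero constant term. Let $\mathrm{NH}_2=\mathrm{End}_{\mathrm{Sym}_2}(\mathrm{Pol}_2)$ be the nilHecke algebra on two strands. It is generated by $x_1,x_2$ (acting by multiplication) and by the divided difference operator $\delta(f)=\frac{f-{}^{s}f}{x_1-x_2}$, where ${}^{s}f$ is $f$ with $x_1,x_2$ exchanged; it is graded by $\deg x_i=2$, $\deg\delta=-2$. Equip $\mathrm{NH}_2$ with the derivation $\partial_a$ of degree $2$ given by $$\partial_a(x_i)=x_i^2,\qquad \partial_a(\delta)=a-(a+1)x_1\delta+(a-1)x_2\delta .$$ It satisfies $\partial_a^p=0$, so $(\mathrm{NH}_2,\partial_a)$ is a $p$-DG algebra. The two-sided ideal $\mathrm{Sym}_2'\cdot\mathrm{NH}_2$ is homogeneous and $\partial_a$-stable, so the quotient $\mathrm{NH}_2/(\mathrm{Sym}_2'\cdot\mathrm{NH}_2)$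 is a $p$-DG algebra with the induced grading and differential. A degree-$0$ morphism $f:U\to W$ of graded $p$-complexes (graded $\Bbbk$-vector spaces with a degree-$2$ differential $\partial$ such that $\partial^p=0$) is an isomorphism up to homotopy if there is a degree-$0$ morphism $g:W\to U$ of $p$-complexes such that $gf-\mathrm{Id}_U$ and $fg-\mathrm{Id}_W$ are null-homotopic, that is, of the form $\sum_{j=0}^{p-1}\partial^{p-1-j}\circ h\circ\partial^{j}$ with $h$ a linear map of degree $2-2p$. A morphism of $p$-DG algebras is a quasi-isomorphism if it is an isomorphism up to homotopy of the underlying $p$-complexes. **Proposition.** As a $\Bbbk$-algebra, $\mathrm{NH}_2/(\mathrm{Sym}_2'\cdot\mathrm{NH}_2)$ is isomorphic to the matrix algebra $\mathrm{M}(2,\Bbbk)$. The canonical projection of $p$-DG algebras $$\pi_2:\mathrm{NH}_2\longrightarrow \mathrm{NH}_2/(\mathrm{Sym}_2'\cdot\mathrm{NH}_2)\cong \mathrm{M}(2,\Bbbk)$$ is a quasi-isomorphism if and only if $a=\pm1$ in $\mathbb{F}_p$. -/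

import Mathlib

universe u

/-! ## Graded p-complexes, p-DG algebras and quasi-isomorphisms -/

/-- A (graded) `p`-complex over `k`: a `ℤ`-graded `k`-vector space with a `k`-linear differential
of degree `2` whose `p`-th power vanishes. -/
structure PComplex (p : ℕ) (k : Type u) [Field k] where
  carrier : Type u
  [addCommGroup : AddCommGroup carrier]
  [module : Module k carrier]
  gr : ℤ → Submodule k carrier
  isInternal : DirectSum.IsInternal gr
  d : carrier →ₗ[k] carrier
  d_mem : ∀ (i : ℤ) (x : carrier), x ∈ gr i → d x ∈ gr (i + 2)
  d_pow : d ^ p = 0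

attribute [instance] PComplex.addCommGroup PComplex.module

/-- A morphism of `p`-complexes: a `k`-linear map of degree `0` commuting with differentials. -/
structure PComplexHom {p : ℕ} {k : Type u} [Field k] (U W : PComplex p k) where
  toLin : U.carrier →ₗ[k] W.carrier
  map_mem : ∀ (i : ℤ) (x : U.carrier), x ∈ U.gr i → toLin x ∈ W.gr i
  comm : ∀ x : U.carrier, toLin (U.d x) = W.d (toLin x)

/-- Two linear maps `f g : U → W` of `p`-complexes are homotopic if
`f - g = ∑_{j=0}^{p-1} d^{p-1-j} ∘ h ∘ d^j` for some linear map `h` of degree `2 - 2p`. -/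
def PHomotopic {p : ℕ} {k : Type u} [Field k] {U W : PComplex p k}
    (f g : U.carrier →ₗ[k] W.carrier) : Prop :=
  ∃ h : U.carrier →ₗ[k] W.carrier,
    (∀ (i : ℤ) (x : U.carrier), x ∈ U.gr i → h x ∈ W.gr (i + (2 - 2 * (p : ℤ)))) ∧
    f - g = ∑ j ∈ Finset.range p, (W.d ^ (p - 1 - j)) ∘ₗ h ∘ₗ (U.d ^ j)

/-- A morphism of `p`-complexes is an isomorphism up to homotopy. -/
def PComplexHom.IsHomotopyEquiv {p : ℕ} {k : Type u} [Field k] {U W : PComplex p k}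
    (f : PComplexHom U W) : Prop :=
  ∃ g : PComplexHom W U,
    PHomotopic (U := U) (W := U) (g.toLin ∘ₗ f.toLin) LinearMap.id ∧
      PHomotopic (U := W) (W := W) (f.toLin ∘ₗ g.toLin) LinearMap.id

/-- A `p`-DG algebra over `k`: a `ℤ`-graded `k`-algebra with a `k`-linear derivation of degree `2`
whose `p`-th power vanishes. -/
structure PDGAlgebra (p : ℕ) (k : Type u) [Field k] where
  carrier : Type u
  [ring : Ring carrier]
  [algebra : Algebra k carrier]
  gr : ℤ → Submodule k carrier
  isInternal : DirectSum.IsInternal gr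
  one_mem : (1 : carrier) ∈ gr 0
  mul_mem : ∀ (i j : ℤ) (x y : carrier), x ∈ gr i → y ∈ gr j → x * y ∈ gr (i + j)
  d : carrier →ₗ[k] carrier
  d_mem : ∀ (i : ℤ) (x : carrier), x ∈ gr i → d x ∈ gr (i + 2)
  leibniz : ∀ x y : carrier, d (x * y) = d x * y + x * d y
  d_pow : d ^ p = 0

attribute [instance] PDGAlgebra.ring PDGAlgebra.algebra

/-- The `p`-complex underlying a `p`-DG algebra. -/
def PDGAlgebra.toPComplex {p : ℕ} {k : Type u} [Field k] (A : PDGAlgebra p k) : PComplex p k where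
  carrier := A.carrier
  gr := A.gr
  isInternal := A.isInternal
  d := A.d
  d_mem := A.d_mem
  d_pow := A.d_pow

/-- A morphism of `p`-DG algebras: a `k`-algebra map of degree `0` commuting with differentials. -/
structure PDGAlgebraHom {p : ℕ} {k : Type u} [Field k] (A B : PDGAlgebra p k) where
  toAlgHom : A.carrier →ₐ[k] B.carrier
  map_mem : ∀ (i : ℤ) (x : A.carrier), x ∈ A.gr i → toAlgHom x ∈ B.gr i
  comm : ∀ x : A.carrier, toAlgHom (A.d x) = B.d (toAlgHom x)

/-- The morphism of `p`-complexes underlying a morphism of `p`-DG algebras. -/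
def PDGAlgebraHom.toPComplexHom {p : ℕ} {k : Type u} [Field k] {A B : PDGAlgebra p k}
    (f : PDGAlgebraHom A B) : PComplexHom A.toPComplex B.toPComplex where
  toLin := f.toAlgHom.toLinearMap
  map_mem := f.map_mem
  comm := f.comm

/-- A quasi-isomorphism of `p`-DG algebras: a morphism inducing an isomorphism of the underlying
`p`-complexes up to homotopy. -/
def PDGAlgebraHom.IsQuasiIso {p : ℕ} {k : Type u} [Field k] {A B : PDGAlgebra p k}
    (f : PDGAlgebraHom A B) : Prop :=
  f.toPComplexHom.IsHomotopyEquiv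

/-- A family of submodules that spans and admits a compatible family of projections is a
direct sum decomposition. -/
theorem isInternal_of_proj {k : Type*} [Field k] {A : Type*} [AddCommGroup A] [Module k A]
    (gr : ℤ → Submodule k A) (π : ℤ → A →ₗ[k] A)
    (h1 : ∀ i, ∀ x ∈ gr i, π i x = x) (h2 : ∀ i j, i ≠ j → ∀ x ∈ gr i, π j x = 0)
    (h3 : ⨆ i, gr i = ⊤) : DirectSum.IsInternal gr := by
  refine DirectSum.isInternal_submodule_of_iSupIndep_of_iSup_eq_top ?_ h3
  intro i
  rw [Submodule.disjoint_def]
  intro x hx hx'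
  have hle : (⨆ j, ⨆ (_ : j ≠ i), gr j) ≤ LinearMap.ker (π i) := by
    refine iSup_le fun j => iSup_le fun hj => fun y hy => ?_
    exact h2 j i hj y hy
  have := hle hx'
  rw [LinearMap.mem_ker, h1 i x hx] at this
  exact this

/-! ## The nilHecke algebra on two strands -/

section NilHecke

open MvPolynomial

/-- The polynomial ring `k[x₁, x₂]`; `x₁ = X 0` and `x₂ = X 1`. -/
abbrev Pol2 (k : Type u) [Field k] : Type u := MvPolynomial (Fin 2) k

/-- The subalgebra of symmetric polynomials in `k[x₁, x₂]`. -/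
abbrev Sym2Pol (k : Type u) [Field k] : Subalgebra k (Pol2 k) :=
  MvPolynomial.symmetricSubalgebra (Fin 2) k

/-- The grading of `k[x₁, x₂]` with `deg x₁ = deg x₂ = 2`. -/
abbrev pol2Gr (k : Type u) [Field k] (m : ℤ) : Submodule k (Pol2 k) :=
  weightedHomogeneousSubmodule k (fun _ : Fin 2 => (2 : ℤ)) m

/-- The nilHecke algebra `NH₂`, the algebra of endomorphisms of `k[x₁, x₂]` that are linear over
the symmetric polynomials. -/
abbrev NH2 (k : Type u) [Field k] : Type u := Module.End (Sym2Pol k) (Pol2 k)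

/-- The degree `d` part of `NH₂`: the endomorphisms of `k[x₁, x₂]` that raise degrees by `d`. -/
def nh2Gr (k : Type u) [Field k] (d : ℤ) : Submodule k (NH2 k) where
  carrier := {ξ | ∀ m : ℤ, ∀ f ∈ pol2Gr k m, ξ f ∈ pol2Gr k (m + d)}
  add_mem' := fun h1 h2 m f hf => Submodule.add_mem _ (h1 m f hf) (h2 m f hf)
  zero_mem' := fun _ _ _ => Submodule.zero_mem _
  smul_mem' := fun c _ h m f hf => Submodule.smul_mem _ c (h m f hf)

/-- The derivation of `k[x₁, x₂]` with `xᵢ ↦ xᵢ²`. -/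
noncomputable def pol2Der (k : Type u) [Field k] : Derivation k (Pol2 k) (Pol2 k) :=
  mkDerivation k fun i => X i ^ 2

/-- The differential `f ↦ ∂ f + (α₁ x₁ + α₂ x₂) f` on `k[x₁, x₂]`, that is, the differential of
the rank one `p`-DG module over `k[x₁, x₂]` whose generator is sent to `α₁ x₁ + α₂ x₂`. -/
noncomputable def pol2Diff {p : ℕ} {k : Type u} [Field k] [CharP k p] (α : Fin 2 → ZMod p) :
    Pol2 k →ₗ[k] Pol2 k :=
  (pol2Der k).toLinearMap + LinearMap.mulLeft k (∑ i, C (ZMod.castHom (dvd_refl p) k (α i)) * X i)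

theorem pol2Diff_apply {p : ℕ} {k : Type u} [Field k] [CharP k p] (α : Fin 2 → ZMod p)
    (f : Pol2 k) : pol2Diff α f =
      pol2Der k f + (∑ i, C (ZMod.castHom (dvd_refl p) k (α i)) * X i) * f := rfl

theorem pol2Der_X {k : Type u} [Field k] (i : Fin 2) : pol2Der k (X i) = X i ^ 2 :=
  mkDerivation_X _ _ _

theorem pol2Der_rename {k : Type u} [Field k] (e : Equiv.Perm (Fin 2)) (f : Pol2 k) :
    pol2Der k (rename e f) = rename e (pol2Der k f) := by
  induction f using MvPolynomial.induction_on with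
  | C c => simp only [rename_C, derivation_C, map_zero]
  | add f g hf hg => simp only [map_add, hf, hg]
  | mul_X f i hf =>
    simp only [map_mul, rename_X, Derivation.leibniz, pol2Der_X, hf, smul_eq_mul, map_add, map_pow]

theorem pol2Der_mem_sym {k : Type u} [Field k] {f : Pol2 k} (hf : f ∈ Sym2Pol k) :
    pol2Der k f ∈ Sym2Pol k := fun e => by
  rw [← pol2Der_rename, hf e]

theorem constantCoeff_pol2Der {k : Type u} [Field k] (f : Pol2 k) :
    constantCoeff (pol2Der k f) = 0 := by
  induction f using MvPolynomial.induction_on with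
  | C c => simp only [derivation_C, map_zero]
  | add f g hf hg => simp only [map_add, hf, hg, add_zero]
  | mul_X f i hf => simp [Derivation.leibniz, pol2Der_X, hf]

theorem pol2Diff_sym_smul {p : ℕ} {k : Type u} [Field k] [CharP k p] (α : Fin 2 → ZMod p)
    (e : Sym2Pol k) (f : Pol2 k) :
    pol2Diff α (e • f) =
      (⟨pol2Der k e, pol2Der_mem_sym e.2⟩ : Sym2Pol k) • f + e • pol2Diff α f := by
  simp only [pol2Diff_apply, Subalgebra.smul_def, smul_eq_mul, Derivation.leibniz]
  ring

/-- The differential `ξ ↦ ∂_α ∘ ξ - ξ ∘ ∂_α` on `NH₂` induced by `pol2Diff α`. -/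
noncomputable def nh2DiffOf {p : ℕ} {k : Type u} [Field k] [CharP k p] (α : Fin 2 → ZMod p) :
    NH2 k →ₗ[k] NH2 k where
  toFun ξ :=
    { toFun := fun f => pol2Diff α (ξ f) - ξ (pol2Diff α f)
      map_add' := fun f g => by simp only [map_add]; abel
      map_smul' := fun e f => by
        simp only [map_smul, pol2Diff_sym_smul, map_add, RingHom.id_apply, smul_sub]
        abel }
  map_add' ξ η := by
    ext1 f
    simp only [LinearMap.add_apply, map_add, LinearMap.coe_mk, AddHom.coe_mk]
    abel
  map_smul' c ξ := by
    ext1 f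
    simp only [LinearMap.smul_apply, map_smul, LinearMap.coe_mk, AddHom.coe_mk, RingHom.id_apply,
      smul_sub]

theorem nh2DiffOf_apply {p : ℕ} {k : Type u} [Field k] [CharP k p] (α : Fin 2 → ZMod p)
    (ξ : NH2 k) (f : Pol2 k) :
    nh2DiffOf α ξ f = pol2Diff α (ξ f) - ξ (pol2Diff α f) := rfl

/-- The differential `∂_a` on `NH₂`, induced by `pol2Diff α` with `α = (0, a)`. -/
noncomputable def nh2Diff {p : ℕ} {k : Type u} [Field k] [CharP k p] (a : ZMod p) :
    NH2 k →ₗ[k] NH2 k :=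
  nh2DiffOf ![0, a]

/-- `∂_a` is induced by every `α = (α₁, α₂)` with `α₂ - α₁ = a`. -/
theorem nh2DiffOf_eq {p : ℕ} {k : Type u} [Field k] [CharP k p] (α : Fin 2 → ZMod p) :
    (nh2DiffOf α : NH2 k →ₗ[k] NH2 k) = nh2Diff (α 1 - α 0) := by
  ext1 ξ
  ext1 f
  have hs : (X 0 + X 1 : Pol2 k) ∈ Sym2Pol k := by
    have h := esymm_isSymmetric (Fin 2) k 1
    rw [esymm_one, Fin.sum_univ_two] at h
    exact h
  have h1 : ∀ f : Pol2 k, ξ ((X 0 + X 1) * f) = (X 0 + X 1) * ξ f :=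
    fun f => ξ.map_smul (⟨_, hs⟩ : Sym2Pol k) f
  have h2 : ∀ (c : k) (f : Pol2 k), ξ (C c * f) = C c * ξ f := fun c f => by
    rw [← smul_eq_C_mul, ← smul_eq_C_mul]
    exact LinearMap.map_smul_of_tower ξ c f
  have h3 : ∀ f : Pol2 k, pol2Diff α f = pol2Diff ![0, α 1 - α 0] f +
      C (ZMod.castHom (dvd_refl p) k (α 0)) * ((X 0 + X 1) * f) := fun f => by
    simp only [pol2Diff_apply, Fin.sum_univ_two, Matrix.cons_val_zero, Matrix.cons_val_one, map_sub,
      map_zero]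
    ring
  rw [nh2Diff, nh2DiffOf_apply, nh2DiffOf_apply, h3, h3 f, map_add, h2, h1]
  abel

theorem nh2Diff_leibniz {p : ℕ} {k : Type u} [Field k] [CharP k p] (a : ZMod p) (ξ η : NH2 k) :
    nh2Diff a (ξ * η) = nh2Diff a ξ * η + ξ * nh2Diff a η := by
  ext1 f
  simp only [nh2Diff, nh2DiffOf_apply, Module.End.mul_apply, LinearMap.add_apply, map_sub]
  abel

/-! ### The differential is `p`-nilpotent -/

/-- The one-variable part of `pol2Diff`. -/
noncomputable def pol2Part {k : Type u} [Field k] (i : Fin 2) (c : k) : Module.End k (Pol2 k) :=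
  LinearMap.mulLeft k (X i ^ 2) ∘ₗ (pderiv i).toLinearMap + LinearMap.mulLeft k (C c * X i)

theorem pol2Part_monomial {k : Type u} [Field k] (i : Fin 2) (c : k) (m : Fin 2 →₀ ℕ) (r : k) :
    pol2Part i c (monomial m r) = ((m i : k) + c) • monomial (m + Finsupp.single i 1) r := by
  have h1 : X i * monomial m r = monomial (m + Finsupp.single i 1) r := by
    rw [X, monomial_mul, one_mul, add_comm]
  have h2 : X i * pderiv i (monomial m r) = (m i : k) • monomial m r := by
    rw [X_mul_pderiv_monomial, Nat.cast_smul_eq_nsmul]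
  change X i ^ 2 * pderiv i (monomial m r) + C c * X i * monomial m r = _
  rw [pow_two, mul_assoc, h2, mul_assoc, h1, Algebra.mul_smul_comm, h1, add_smul, ← smul_eq_C_mul]

theorem pol2Part_comm {k : Type u} [Field k] (c c' : k) :
    Commute (pol2Part 0 c) (pol2Part 1 c') := by
  refine MvPolynomial.linearMap_ext fun m => LinearMap.ext_ring ?_
  simp only [LinearMap.comp_apply, Module.End.mul_apply, pol2Part_monomial, map_smul]
  rw [smul_comm]
  simp [add_right_comm]

theorem pol2Part_pow_monomial {k : Type u} [Field k] (i : Fin 2) (c : k) (n : ℕ)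
    (m : Fin 2 →₀ ℕ) (r : k) :
    (pol2Part i c ^ n) (monomial m r) =
      (∏ l ∈ Finset.range n, ((m i : k) + c + l)) • monomial (m + Finsupp.single i n) r := by
  induction n with
  | zero => simp
  | succ n ih =>
    rw [pow_succ', Module.End.mul_apply, ih, map_smul, pol2Part_monomial, smul_smul,
      Finset.prod_range_succ]
    congr 1
    · simp only [Finsupp.add_apply, Finsupp.single_eq_same]
      push_cast
      ring
    · rw [add_assoc, ← Finsupp.single_add]

theorem pol2Part_pow_char {p : ℕ} [Fact p.Prime] {k : Type u} [Field k] [CharP k p] (i : Fin 2)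
    (c : ZMod p) : pol2Part i (ZMod.castHom (dvd_refl p) k c) ^ p = 0 := by
  refine MvPolynomial.linearMap_ext fun m => LinearMap.ext_ring ?_
  simp only [LinearMap.comp_apply, pol2Part_pow_monomial, LinearMap.zero_apply]
  have hz : ∏ l ∈ Finset.range p, ((m i : k) + ZMod.castHom (dvd_refl p) k c + (l : k)) = 0 := by
    refine Finset.prod_eq_zero (i := (-((m i : ZMod p) + c)).val)
      (Finset.mem_range.2 (ZMod.val_lt _)) ?_
    have h : ((m i : ZMod p) + c) + (((-((m i : ZMod p) + c)).val : ℕ) : ZMod p) = 0 := by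
      rw [ZMod.natCast_zmod_val, add_neg_cancel]
    have h' := congrArg (ZMod.castHom (dvd_refl p) k) h
    simpa only [map_add, map_natCast, map_zero] using h'
  rw [hz, zero_smul]

theorem pol2Diff_eq {p : ℕ} {k : Type u} [Field k] [CharP k p] (α : Fin 2 → ZMod p) :
    (pol2Diff α : Module.End k (Pol2 k)) =
      pol2Part 0 (ZMod.castHom (dvd_refl p) k (α 0)) +
        pol2Part 1 (ZMod.castHom (dvd_refl p) k (α 1)) := by
  have h : ∀ f : Pol2 k, pol2Der k f = X 0 ^ 2 * pderiv 0 f + X 1 ^ 2 * pderiv 1 f := by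
    intro f
    induction f using MvPolynomial.induction_on with
    | C c => simp
    | add f g hf hg => simp only [map_add, hf, hg]; ring
    | mul_X f i hf =>
      simp only [Derivation.leibniz, pol2Der_X, hf, smul_eq_mul]
      fin_cases i <;> simp [pderiv_X] <;> ring
  refine LinearMap.ext fun f => ?_
  rw [pol2Diff_apply, h, Fin.sum_univ_two]
  simp only [pol2Part, LinearMap.add_apply, LinearMap.comp_apply, LinearMap.mulLeft_apply,
    Derivation.coeFn_coe]
  ring

instance charP_end_pol2 {p : ℕ} {k : Type u} [Field k] [CharP k p] :
    CharP (Module.End k (Pol2 k)) p :=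
  charP_of_injective_algebraMap (algebraMap k (Module.End k (Pol2 k))).injective p

theorem pol2Diff_pow {p : ℕ} [Fact p.Prime] {k : Type u} [Field k] [CharP k p]
    (α : Fin 2 → ZMod p) : (pol2Diff α : Module.End k (Pol2 k)) ^ p = 0 := by
  rw [pol2Diff_eq, add_pow_char_of_commute _ (pol2Part_comm _ _), pol2Part_pow_char,
    pol2Part_pow_char, add_zero]

theorem nh2DiffOf_pow_apply {p : ℕ} {k : Type u} [Field k] [CharP k p] (α : Fin 2 → ZMod p)
    (n : ℕ) (ξ : NH2 k) :
    ((nh2DiffOf α ^ n) ξ).restrictScalars k =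
      ((LinearMap.mulLeft k (pol2Diff α : Module.End k (Pol2 k)) -
        LinearMap.mulRight k (pol2Diff α : Module.End k (Pol2 k))) ^ n) (ξ.restrictScalars k) := by
  induction n with
  | zero => rfl
  | succ n ih =>
    rw [pow_succ', pow_succ', Module.End.mul_apply, Module.End.mul_apply, ← ih]
    rfl

theorem sub_pow_char_eq_zero {p : ℕ} [Fact p.Prime] {A : Type*} [Ring A] (hc : CharP A p) (L R : A)
    (h : Commute L R) (hL : L ^ p = 0) (hR : R ^ p = 0) : (L - R) ^ p = 0 := by
  rw [sub_pow_char_of_commute _ h, hL, hR, sub_zero]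

theorem nh2Diff_pow {p : ℕ} [Fact p.Prime] {k : Type u} [Field k] [CharP k p] (a : ZMod p) :
    (nh2Diff a : NH2 k →ₗ[k] NH2 k) ^ p = 0 := by
  have hc : CharP (Module.End k (Module.End k (Pol2 k))) p :=
    charP_of_injective_algebraMap
      (algebraMap k (Module.End k (Module.End k (Pol2 k)))).injective p
  have h0 := sub_pow_char_eq_zero hc (LinearMap.mulLeft k (pol2Diff ![0, a] : Module.End k (Pol2 k)))
    (LinearMap.mulRight k (pol2Diff ![0, a] : Module.End k (Pol2 k)))
    (LinearMap.commute_mulLeft_right _ _)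
    (by rw [LinearMap.pow_mulLeft, pol2Diff_pow, LinearMap.mulLeft_zero_eq_zero])
    (by rw [LinearMap.pow_mulRight, pol2Diff_pow, LinearMap.mulRight_zero_eq_zero])
  ext1 ξ
  refine LinearMap.restrictScalars_injective k ?_
  rw [nh2Diff, nh2DiffOf_pow_apply, h0]
  rfl

/-! ### The divided difference operator and the standard basis -/

/-- Transposition of the two variables. -/
noncomputable def pol2Swap {k : Type u} [Field k] : Pol2 k →ₐ[k] Pol2 k :=
  rename (Equiv.swap (0 : Fin 2) 1)

theorem pol2Swap_X0 {k : Type u} [Field k] : pol2Swap (X 0 : Pol2 k) = X 1 := by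
  rw [pol2Swap, rename_X, Equiv.swap_apply_left]

theorem pol2Swap_X1 {k : Type u} [Field k] : pol2Swap (X 1 : Pol2 k) = X 0 := by
  rw [pol2Swap, rename_X, Equiv.swap_apply_right]

theorem pol2Swap_swap {k : Type u} [Field k] (f : Pol2 k) : pol2Swap (pol2Swap f) = f := by
  rw [pol2Swap, rename_rename, ← Equiv.coe_trans, Equiv.swap_swap, Equiv.coe_refl, rename_id_apply]

theorem pol2_sub_ne_zero {k : Type u} [Field k] : (X 0 - X 1 : Pol2 k) ≠ 0 :=
  sub_ne_zero.2 fun h => by simpa using X_injective h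

theorem exists_pol2_divDiff {k : Type u} [Field k] (f : Pol2 k) :
    ∃ g : Pol2 k, (X 0 - X 1) * g = f - pol2Swap f := by
  induction f using MvPolynomial.induction_on with
  | C c => exact ⟨0, by simp [pol2Swap]⟩
  | add f g hf hg =>
    obtain ⟨u, hu⟩ := hf
    obtain ⟨v, hv⟩ := hg
    exact ⟨u + v, by rw [mul_add, hu, hv, map_add]; ring⟩
  | mul_X f i hf =>
    obtain ⟨u, hu⟩ := hf
    fin_cases i
    · refine ⟨X 0 * u + pol2Swap f, ?_⟩
      simp only [map_mul, Fin.zero_eta, pol2Swap_X0]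
      linear_combination X 0 * hu
    · refine ⟨X 1 * u - pol2Swap f, ?_⟩
      simp only [map_mul, Fin.mk_one, pol2Swap_X1]
      linear_combination X 1 * hu

theorem pol2Swap_sym {k : Type u} [Field k] (e : Sym2Pol k) :
    pol2Swap (e : Pol2 k) = e := e.2 _

/-- The divided difference operator `δ f = (f - ˢf) / (x₁ - x₂)`, as an element of `NH₂`. -/
noncomputable def nh2Delta (k : Type u) [Field k] : NH2 k where
  toFun f := (exists_pol2_divDiff f).choose
  map_add' f g := by
    refine mul_left_cancel₀ pol2_sub_ne_zero ?_
    rw [mul_add, (exists_pol2_divDiff (f + g)).choose_spec, (exists_pol2_divDiff f).choose_spec,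
      (exists_pol2_divDiff g).choose_spec, map_add]
    ring
  map_smul' e f := by
    refine mul_left_cancel₀ pol2_sub_ne_zero ?_
    rw [(exists_pol2_divDiff (e • f)).choose_spec, RingHom.id_apply, Subalgebra.smul_def,
      Subalgebra.smul_def, smul_eq_mul, smul_eq_mul, mul_left_comm,
      (exists_pol2_divDiff f).choose_spec, map_mul, pol2Swap_sym]
    ring

theorem nh2Delta_spec {k : Type u} [Field k] (f : Pol2 k) :
    (X 0 - X 1) * nh2Delta k f = f - pol2Swap f :=
  (exists_pol2_divDiff f).choose_spec

/-- Multiplication by a polynomial, as an element of `NH₂`. -/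
noncomputable def nh2Mul {k : Type u} [Field k] : Pol2 k →ₐ[k] NH2 k :=
  Algebra.lsmul k (Sym2Pol k) (Pol2 k)

theorem nh2Mul_apply {k : Type u} [Field k] (f g : Pol2 k) : nh2Mul f g = f * g := rfl

/-- The defining relations of the nilHecke algebra on two strands. -/
theorem nh2_relations (k : Type u) [Field k] :
    nh2Delta k * nh2Delta k = 0 ∧
    nh2Mul (X 0) * nh2Delta k - nh2Delta k * nh2Mul (X 1) = 1 ∧
    nh2Delta k * nh2Mul (X 0) - nh2Mul (X 1) * nh2Delta k = 1 := by
  have hs : ∀ f : Pol2 k, pol2Swap (nh2Delta k f) = nh2Delta k f := fun f => by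
    refine mul_left_cancel₀ pol2_sub_ne_zero ?_
    have h := congrArg pol2Swap (nh2Delta_spec f)
    simp only [map_mul, map_sub, pol2Swap_X0, pol2Swap_X1, pol2Swap_swap] at h
    linear_combination (-1 : Pol2 k) * h - nh2Delta_spec f
  refine ⟨?_, ?_, ?_⟩ <;> ext1 f <;> refine mul_left_cancel₀ pol2_sub_ne_zero ?_
  · rw [Module.End.mul_apply, nh2Delta_spec, hs, sub_self, LinearMap.zero_apply, mul_zero]
  · have h1 := nh2Delta_spec f
    have h2 := nh2Delta_spec (X 1 * f)
    simp only [map_mul, pol2Swap_X1] at h2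
    simp only [LinearMap.sub_apply, Module.End.mul_apply, Module.End.one_apply, nh2Mul_apply]
    linear_combination X 0 * h1 - h2
  · have h1 := nh2Delta_spec f
    have h2 := nh2Delta_spec (X 0 * f)
    simp only [map_mul, pol2Swap_X0] at h2
    simp only [LinearMap.sub_apply, Module.End.mul_apply, Module.End.one_apply, nh2Mul_apply]
    linear_combination h2 - X 1 * h1

theorem nh2Delta_one (k : Type u) [Field k] : nh2Delta k 1 = 0 := by
  refine mul_left_cancel₀ pol2_sub_ne_zero ?_
  rw [nh2Delta_spec, map_one, sub_self, mul_zero]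

theorem nh2Delta_X (k : Type u) [Field k] : nh2Delta k (X 0) = 1 := by
  refine mul_left_cancel₀ pol2_sub_ne_zero ?_
  rw [nh2Delta_spec, pol2Swap_X0, mul_one]

/-- `k[x₁, x₂]` is spanned by `1` and `x₁` over the symmetric polynomials. -/
theorem pol2_eq_sym (k : Type u) [Field k] (f : Pol2 k) :
    ∃ u v : Sym2Pol k, f = u • (1 : Pol2 k) + v • (X 0 : Pol2 k) := by
  have hs1 : (X 0 + X 1 : Pol2 k) ∈ Sym2Pol k := by
    have h := esymm_isSymmetric (Fin 2) k 1
    rw [esymm_one, Fin.sum_univ_two] at h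
    exact h
  have hs2 : (X 0 * X 1 : Pol2 k) ∈ Sym2Pol k := fun e => by
    rw [map_mul, rename_X, rename_X]
    rw [← Fin.prod_univ_two (fun i => (X i : Pol2 k)), ← Equiv.prod_comp e, Fin.prod_univ_two]
  induction f using MvPolynomial.induction_on with
  | C c =>
    refine ⟨⟨C c, IsSymmetric.C c⟩, 0, ?_⟩
    simp [Subalgebra.smul_def]
  | add f g hf hg =>
    obtain ⟨u, v, h⟩ := hf
    obtain ⟨u', v', h'⟩ := hg
    refine ⟨u + u', v + v', ?_⟩
    rw [h, h', add_smul, add_smul]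
    abel
  | mul_X f i hf =>
    obtain ⟨u, v, h⟩ := hf
    fin_cases i
    · refine ⟨-(⟨_, hs2⟩ * v), u + ⟨_, hs1⟩ * v, ?_⟩
      rw [h]
      simp only [Subalgebra.smul_def, smul_eq_mul, Fin.zero_eta]
      push_cast
      ring
    · refine ⟨⟨_, hs1⟩ * u + ⟨_, hs2⟩ * v, -u, ?_⟩
      rw [h]
      simp only [Subalgebra.smul_def, smul_eq_mul, Fin.mk_one]
      push_cast
      ring

theorem nh2_ext {k : Type u} [Field k] {ξ η : NH2 k} (h1 : ξ 1 = η 1)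
    (h2 : ξ (X 0) = η (X 0)) : ξ = η := by
  ext1 f
  obtain ⟨u, v, rfl⟩ := pol2_eq_sym k f
  simp only [map_add, map_smul, h1, h2]

/-- The coefficient of `δ` of an element of `NH₂`. -/
noncomputable def nh2Coeff (k : Type u) [Field k] : NH2 k →ₗ[k] Pol2 k where
  toFun ξ := ξ (X 0) - X 0 * ξ 1
  map_add' ξ η := by simp only [LinearMap.add_apply]; ring
  map_smul' c ξ := by
    simp only [LinearMap.smul_apply, RingHom.id_apply, smul_sub, Algebra.mul_smul_comm]

/-- Every element of `NH₂` is `f + g δ` for polynomials `f` and `g`. -/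
theorem nh2_eq {k : Type u} [Field k] (ξ : NH2 k) :
    ξ = nh2Mul (ξ 1) + nh2Mul (nh2Coeff k ξ) * nh2Delta k := by
  refine nh2_ext ?_ ?_
  · simp only [LinearMap.add_apply, Module.End.mul_apply, nh2Mul_apply, nh2Delta_one]
    ring
  · simp only [LinearMap.add_apply, Module.End.mul_apply, nh2Mul_apply, nh2Delta_X]
    simp only [nh2Coeff, LinearMap.coe_mk, AddHom.coe_mk]
    ring

/-- The values of `∂_a` on the generators of `NH₂`. -/
theorem nh2Diff_generators {p : ℕ} {k : Type u} [Field k] [CharP k p] (a : ZMod p) :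
    (∀ i : Fin 2, nh2Diff a (nh2Mul (X i) : NH2 k) = nh2Mul (X i) ^ 2) ∧
    nh2Diff a (nh2Delta k) =
      algebraMap k (NH2 k) (ZMod.castHom (dvd_refl p) k a)
        - (ZMod.castHom (dvd_refl p) k a + 1) • (nh2Mul (X 0) * nh2Delta k)
        + (ZMod.castHom (dvd_refl p) k a - 1) • (nh2Mul (X 1) * nh2Delta k) := by
  refine ⟨fun i => ?_, ?_⟩
  · ext1 f
    rw [pow_two]
    simp only [nh2Diff, nh2DiffOf_apply, nh2Mul_apply, pol2Diff_apply, Derivation.leibniz, pol2Der_X,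
      smul_eq_mul, Module.End.mul_apply]
    ring
  · generalize hc : ZMod.castHom (dvd_refl p) k a = c
    have hX : nh2Delta k (X 0 ^ 2) = X 0 + X 1 := by
      refine mul_left_cancel₀ pol2_sub_ne_zero ?_
      rw [nh2Delta_spec, map_pow, pol2Swap_X0]
      ring
    have hY : nh2Delta k (X 1) = -1 := by
      refine mul_left_cancel₀ pol2_sub_ne_zero ?_
      rw [nh2Delta_spec, pol2Swap_X1]
      ring
    have hXY : nh2Delta k (X 1 * X 0) = 0 := by
      refine mul_left_cancel₀ pol2_sub_ne_zero ?_
      rw [nh2Delta_spec, map_mul, pol2Swap_X0, pol2Swap_X1]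
      ring
    have hd : ∀ f : Pol2 k, pol2Diff ![0, a] f = pol2Der k f + c • (X 1 * f) := fun f => by
      rw [pol2Diff_apply, Fin.sum_univ_two, smul_eq_C_mul]
      simp only [Matrix.cons_val_zero, Matrix.cons_val_one, map_zero, hc]
      ring
    have hk : ∀ f : Pol2 k, nh2Delta k (c • f) = c • nh2Delta k f :=
      fun f => LinearMap.map_smul_of_tower _ c f
    refine nh2_ext ?_ ?_
    · simp only [nh2Diff, nh2DiffOf_apply, hd, map_add, hk, nh2Delta_one, map_zero, mul_zero,
        LinearMap.add_apply, LinearMap.sub_apply, LinearMap.smul_apply, Module.End.mul_apply,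
        smul_zero, Derivation.map_one_eq_zero, mul_one, hY, Module.algebraMap_end_apply]
      simp
    · simp only [nh2Diff, nh2DiffOf_apply, hd, map_add, hk, nh2Delta_X, mul_one, pol2Der_X,
        LinearMap.add_apply, LinearMap.sub_apply, LinearMap.smul_apply, Module.End.mul_apply,
        smul_zero, Derivation.map_one_eq_zero, hX, hXY, Module.algebraMap_end_apply, nh2Mul_apply]
      simp only [smul_eq_C_mul, map_add, map_sub, map_one]
      ring

/-! ### The grading of `NH₂` -/

theorem pol2Swap_mem_gr {k : Type u} [Field k] {m : ℤ} {f : Pol2 k} (hf : f ∈ pol2Gr k m)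
    (e : Equiv.Perm (Fin 2)) : rename e f ∈ pol2Gr k m := by
  intro d hd
  obtain ⟨u, rfl, hu⟩ := coeff_rename_ne_zero e f d hd
  have := hf hu
  rw [← this]
  simp only [Finsupp.weight_apply]
  rw [Finsupp.sum_mapDomain_index (by simp) (by intros; simp [add_mul])]

theorem mem_gr_of_sub_mul {k : Type u} [Field k] {m : ℤ} {g : Pol2 k}
    (h : (X 0 - X 1) * g ∈ pol2Gr k (m + 2)) : g ∈ pol2Gr k m := by
  have hx : (X 0 - X 1 : Pol2 k) ∈ pol2Gr k 2 :=
    Submodule.sub_mem _ (isWeightedHomogeneous_X k _ 0) (isWeightedHomogeneous_X k _ 1)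
  have key : ∀ n : ℤ, n ≠ m → weightedHomogeneousComponent (fun _ : Fin 2 => (2 : ℤ)) n g = 0 := by
    intro n hn
    refine mul_left_cancel₀ pol2_sub_ne_zero ?_
    rw [mul_zero]
    have h1 : weightedHomogeneousComponent (fun _ : Fin 2 => (2 : ℤ)) (n + 2) ((X 0 - X 1) * g) = 0 :=
      IsWeightedHomogeneous.weightedHomogeneousComponent_ne _ h (by omega)
    rw [← h1]
    have h2 : ∀ g : Pol2 k,
        weightedHomogeneousComponent (fun _ : Fin 2 => (2 : ℤ)) (n + 2) ((X 0 - X 1) * g) =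
        (X 0 - X 1) * weightedHomogeneousComponent (fun _ : Fin 2 => (2 : ℤ)) n g := by
      intro g
      induction g using MvPolynomial.induction_on' with
      | monomial u r =>
        have hm : (monomial u r : Pol2 k) ∈
            pol2Gr k (Finsupp.weight (fun _ : Fin 2 => (2 : ℤ)) u) :=
          isWeightedHomogeneous_monomial _ _ _ rfl
        have hm' := IsWeightedHomogeneous.mul hx hm
        rw [weightedHomogeneousComponent_of_mem hm, weightedHomogeneousComponent_of_mem hm']
        split_ifs <;> first | rfl | omega | simp
      | add f g hf hg => rw [mul_add, map_add, hf, hg, map_add, mul_add]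
    exact (h2 g).symm
  intro d hd
  by_contra hne
  have h1 := congrArg (coeff d) (key _ hne)
  rw [coeff_weightedHomogeneousComponent, if_pos rfl, coeff_zero] at h1
  exact hd h1

theorem nh2Delta_mem (k : Type u) [Field k] : nh2Delta k ∈ nh2Gr k (-2) := by
  intro m f hf
  refine mem_gr_of_sub_mul ?_
  rw [nh2Delta_spec, neg_add_cancel_right]
  exact Submodule.sub_mem _ hf (pol2Swap_mem_gr hf _)

theorem nh2Mul_mem {k : Type u} [Field k] {m : ℤ} {f : Pol2 k} (hf : f ∈ pol2Gr k m) :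
    nh2Mul f ∈ nh2Gr k m := by
  intro n g hg
  rw [nh2Mul_apply, add_comm]
  exact IsWeightedHomogeneous.mul hf hg

theorem nh2_mul_mem {k : Type u} [Field k] (i j : ℤ) (ξ η : NH2 k) (h1 : ξ ∈ nh2Gr k i)
    (h2 : η ∈ nh2Gr k j) : ξ * η ∈ nh2Gr k (i + j) := by
  intro m f hf
  have := h1 _ _ (h2 m f hf)
  rwa [show m + (i + j) = m + j + i by ring]

/-- The projection of `NH₂` to its degree `d` part: `f + g δ ↦ f_d + g_{d+2} δ`. -/
noncomputable def nh2Proj (k : Type u) [Field k] (d : ℤ) : NH2 k →ₗ[k] NH2 k where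
  toFun ξ :=
    nh2Mul (weightedHomogeneousComponent (fun _ : Fin 2 => (2 : ℤ)) d (ξ 1)) +
      nh2Mul (weightedHomogeneousComponent (fun _ : Fin 2 => (2 : ℤ)) (d + 2) (nh2Coeff k ξ)) *
        nh2Delta k
  map_add' ξ η := by
    simp only [LinearMap.add_apply, map_add, add_mul]
    abel
  map_smul' c ξ := by
    simp only [LinearMap.smul_apply, map_smul, RingHom.id_apply, smul_add, smul_mul_assoc]

theorem nh2Proj_apply {k : Type u} [Field k] (d : ℤ) (ξ : NH2 k) : nh2Proj k d ξ =
    nh2Mul (weightedHomogeneousComponent (fun _ : Fin 2 => (2 : ℤ)) d (ξ 1)) +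
      nh2Mul (weightedHomogeneousComponent (fun _ : Fin 2 => (2 : ℤ)) (d + 2) (nh2Coeff k ξ)) *
        nh2Delta k := rfl

theorem nh2_mem_coeff {k : Type u} [Field k] {d : ℤ} {ξ : NH2 k} (h : ξ ∈ nh2Gr k d) :
    ξ 1 ∈ pol2Gr k d ∧ nh2Coeff k ξ ∈ pol2Gr k (d + 2) := by
  have h1 : ξ 1 ∈ pol2Gr k d := by
    have := h 0 1 (isWeightedHomogeneous_one k _)
    rwa [zero_add] at this
  refine ⟨h1, Submodule.sub_mem _ ?_ ?_⟩
  · rw [add_comm]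
    exact h 2 _ (isWeightedHomogeneous_X k _ 0)
  · rw [add_comm]
    exact IsWeightedHomogeneous.mul (isWeightedHomogeneous_X k _ 0) h1

theorem nh2Proj_same {k : Type u} [Field k] (d : ℤ) (ξ : NH2 k) (h : ξ ∈ nh2Gr k d) :
    nh2Proj k d ξ = ξ := by
  obtain ⟨h1, h2⟩ := nh2_mem_coeff h
  rw [nh2Proj_apply, IsWeightedHomogeneous.weightedHomogeneousComponent_same h1,
    IsWeightedHomogeneous.weightedHomogeneousComponent_same h2, ← nh2_eq]

theorem nh2Proj_ne {k : Type u} [Field k] (i j : ℤ) (hij : i ≠ j) (ξ : NH2 k)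
    (h : ξ ∈ nh2Gr k i) : nh2Proj k j ξ = 0 := by
  obtain ⟨h1, h2⟩ := nh2_mem_coeff h
  rw [nh2Proj_apply, IsWeightedHomogeneous.weightedHomogeneousComponent_ne _ h1 hij.symm,
    IsWeightedHomogeneous.weightedHomogeneousComponent_ne _ h2 (by omega), map_zero, zero_mul,
    add_zero]

theorem pol2Gr_iSup (k : Type u) [Field k] : ⨆ m, pol2Gr k m = ⊤ := by
  rw [eq_top_iff]
  intro f _
  induction f using MvPolynomial.induction_on' with
  | monomial u r =>
    exact Submodule.mem_iSup_of_mem _ (isWeightedHomogeneous_monomial _ u r rfl)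
  | add f g hf hg => exact Submodule.add_mem _ (hf trivial) (hg trivial)

theorem nh2Gr_iSup (k : Type u) [Field k] : ⨆ d, nh2Gr k d = ⊤ := by
  have h1 : ∀ f : Pol2 k, nh2Mul f ∈ ⨆ d, nh2Gr k d := by
    intro f
    have hf : f ∈ ⨆ m, pol2Gr k m := by rw [pol2Gr_iSup]; trivial
    refine Submodule.iSup_induction _ (motive := fun f => nh2Mul f ∈ ⨆ d, nh2Gr k d) hf
      (fun m f hf => Submodule.mem_iSup_of_mem m (nh2Mul_mem hf)) ?_ ?_
    · rw [map_zero]; exact Submodule.zero_mem _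
    · intro f g hf hg
      rw [map_add]; exact Submodule.add_mem _ hf hg
  have h2 : ∀ f : Pol2 k, nh2Mul f * nh2Delta k ∈ ⨆ d, nh2Gr k d := by
    intro f
    have hf : f ∈ ⨆ m, pol2Gr k m := by rw [pol2Gr_iSup]; trivial
    refine Submodule.iSup_induction _
      (motive := fun f => nh2Mul f * nh2Delta k ∈ ⨆ d, nh2Gr k d) hf
      (fun m f hf => Submodule.mem_iSup_of_mem (m + -2)
        (nh2_mul_mem _ _ _ _ (nh2Mul_mem hf) (nh2Delta_mem k))) ?_ ?_
    · rw [map_zero, zero_mul]; exact Submodule.zero_mem _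
    · intro f g hf hg
      rw [map_add, add_mul]; exact Submodule.add_mem _ hf hg
  rw [eq_top_iff]
  intro ξ _
  rw [nh2_eq ξ]
  exact Submodule.add_mem _ (h1 _) (h2 _)

theorem pol2Diff_mem {p : ℕ} {k : Type u} [Field k] [CharP k p] (α : Fin 2 → ZMod p) (m : ℤ)
    (f : Pol2 k) (hf : f ∈ pol2Gr k m) : pol2Diff α f ∈ pol2Gr k (m + 2) := by
  have hd : ∀ i (c : k), pol2Part i c f ∈ pol2Gr k (m + 2) := by
    intro i c
    refine IsWeightedHomogeneous.induction_on
      (motive := fun f _ => pol2Part i c f ∈ pol2Gr k (m + 2)) ?_ ?_ ?_ hf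
    · rw [map_zero]; exact Submodule.zero_mem _
    · intro f g _ _ h1 h2
      rw [map_add]; exact Submodule.add_mem _ h1 h2
    · intro d r hd
      rw [pol2Part_monomial]
      refine Submodule.smul_mem _ _ (isWeightedHomogeneous_monomial _ _ _ ?_)
      rw [map_add, hd]
      simp [Finsupp.weight_apply]
  have := LinearMap.congr_fun (pol2Diff_eq (k := k) α) f
  rw [this]
  exact Submodule.add_mem _ (hd _ _) (hd _ _)

theorem nh2Diff_mem {p : ℕ} {k : Type u} [Field k] [CharP k p] (a : ZMod p) (i : ℤ) (ξ : NH2 k)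
    (h : ξ ∈ nh2Gr k i) : nh2Diff a ξ ∈ nh2Gr k (i + 2) := by
  intro m f hf
  refine Submodule.sub_mem _ ?_ ?_
  · rw [← add_assoc]
    exact pol2Diff_mem _ _ _ (h m f hf)
  · rw [show m + (i + 2) = m + 2 + i by ring]
    exact h _ _ (pol2Diff_mem _ _ _ hf)

/-- The `p`-DG algebra `(NH₂, ∂_a)`. -/
noncomputable def nh2PDG (p : ℕ) [Fact p.Prime] (k : Type u) [Field k] [CharP k p] (a : ZMod p) :
    PDGAlgebra p k where
  carrier := NH2 k
  gr := nh2Gr k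
  isInternal := isInternal_of_proj _ (nh2Proj k) nh2Proj_same nh2Proj_ne (nh2Gr_iSup k)
  one_mem := fun m f hf => by rwa [add_zero]
  mul_mem := nh2_mul_mem
  d := nh2Diff a
  d_mem := nh2Diff_mem a
  leibniz := nh2Diff_leibniz a
  d_pow := nh2Diff_pow a

/-! ### The quotient by the symmetric polynomials without constant term -/

/-- The symmetric polynomials with zero constant term. -/
def sym2Aug (k : Type u) [Field k] : Submodule k (Pol2 k) where
  carrier := {e | e ∈ Sym2Pol k ∧ constantCoeff e = 0}
  add_mem' := fun h1 h2 => ⟨add_mem h1.1 h2.1, by rw [map_add, h1.2, h2.2, add_zero]⟩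
  zero_mem' := ⟨zero_mem _, map_zero _⟩
  smul_mem' := fun c _ h => ⟨Subalgebra.smul_mem _ h.1 c, by
    rw [smul_eq_C_mul, map_mul, h.2, mul_zero]⟩

theorem nh2Mul_central {k : Type u} [Field k] {e : Pol2 k} (he : e ∈ sym2Aug k) (ξ : NH2 k) :
    nh2Mul e * ξ = ξ * nh2Mul e := by
  ext1 f
  exact (ξ.map_smul (⟨e, he.1⟩ : Sym2Pol k) f).symm

/-- The ideal `Sym₂' · NH₂` of `NH₂` generated by the symmetric polynomials with zero constant term
(which are central in `NH₂`). -/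
noncomputable def nh2Ideal (k : Type u) [Field k] : Ideal (NH2 k) :=
  Ideal.span {ξ | ∃ e ∈ sym2Aug k, nh2Mul e = ξ}

theorem mul_mem_nh2Ideal {k : Type u} [Field k] (ξ : NH2 k) {e : Pol2 k} (he : e ∈ sym2Aug k) :
    nh2Mul e * ξ ∈ nh2Ideal k := by
  rw [nh2Mul_central he]
  exact Ideal.mul_mem_left _ _ (Ideal.subset_span ⟨e, he, rfl⟩)

theorem nh2Ideal_induction {k : Type u} [Field k] {P : NH2 k → Prop}
    (h0 : P 0) (hadd : ∀ ξ η, P ξ → P η → P (ξ + η))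
    (hmul : ∀ (ξ : NH2 k), ∀ e ∈ sym2Aug k, P (nh2Mul e * ξ))
    {ξ : NH2 k} (h : ξ ∈ nh2Ideal k) : P ξ := by
  have key : ∀ η : NH2 k, P (η * ξ) := by
    refine Submodule.span_induction (p := fun ξ _ => ∀ η : NH2 k, P (η * ξ)) ?_ ?_ ?_ ?_ h
    · rintro _ ⟨e, he, rfl⟩ η
      rw [← nh2Mul_central he]
      exact hmul η e he
    · intro η; rwa [mul_zero]
    · intro ξ ξ' _ _ h1 h2 η
      rw [mul_add]
      exact hadd _ _ (h1 η) (h2 η)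
    · intro c ξ _ h1 η
      rw [smul_eq_mul, ← mul_assoc]
      exact h1 _
  have := key 1
  rwa [one_mul] at this

instance nh2Ideal_isTwoSided (k : Type u) [Field k] : (nh2Ideal k).IsTwoSided where
  mul_mem_of_left := fun {ξ} η h => by
    refine nh2Ideal_induction (P := fun ξ => ξ * η ∈ nh2Ideal k) ?_ ?_ ?_ h
    · rw [zero_mul]; exact Ideal.zero_mem _
    · intro ξ ξ' h1 h2
      rw [add_mul]; exact Ideal.add_mem _ h1 h2
    · intro ξ e he
      rw [mul_assoc]
      exact mul_mem_nh2Ideal _ he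

theorem nh2Diff_nh2Mul {p : ℕ} {k : Type u} [Field k] [CharP k p] (a : ZMod p)
    (e : Pol2 k) : nh2Diff a (nh2Mul e : NH2 k) = nh2Mul (pol2Der k e) := by
  ext1 f
  simp only [nh2Diff, nh2DiffOf_apply, nh2Mul_apply, pol2Diff_apply, Derivation.leibniz,
    smul_eq_mul]
  ring

theorem pol2Der_mem_sym2Aug {k : Type u} [Field k] {e : Pol2 k} (he : e ∈ sym2Aug k) :
    pol2Der k e ∈ sym2Aug k :=
  ⟨pol2Der_mem_sym he.1, constantCoeff_pol2Der e⟩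

theorem nh2Diff_mem_ideal {p : ℕ} {k : Type u} [Field k] [CharP k p] (a : ZMod p) (ξ : NH2 k)
    (h : ξ ∈ nh2Ideal k) : nh2Diff a ξ ∈ nh2Ideal k := by
  refine nh2Ideal_induction (P := fun ξ => nh2Diff a ξ ∈ nh2Ideal k) ?_ ?_ ?_ h
  · rw [map_zero]; exact Ideal.zero_mem _
  · intro ξ ξ' h1 h2
    rw [map_add]; exact Ideal.add_mem _ h1 h2
  · intro ξ e he
    rw [nh2Diff_leibniz, nh2Diff_nh2Mul]
    exact Ideal.add_mem _ (mul_mem_nh2Ideal _ (pol2Der_mem_sym2Aug he)) (mul_mem_nh2Ideal _ he)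

theorem sym_component {k : Type u} [Field k] {f : Pol2 k} (hf : f ∈ Sym2Pol k) (m : ℤ) :
    weightedHomogeneousComponent (fun _ : Fin 2 => (2 : ℤ)) m f ∈ Sym2Pol k := by
  intro e
  have h : ∀ f : Pol2 k, rename e (weightedHomogeneousComponent (fun _ : Fin 2 => (2 : ℤ)) m f) =
      weightedHomogeneousComponent (fun _ : Fin 2 => (2 : ℤ)) m (rename e f) := by
    intro f
    induction f using MvPolynomial.induction_on' with
    | monomial u r =>
      have hm : (monomial u r : Pol2 k) ∈
          pol2Gr k (Finsupp.weight (fun _ : Fin 2 => (2 : ℤ)) u) :=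
        isWeightedHomogeneous_monomial _ _ _ rfl
      rw [weightedHomogeneousComponent_of_mem hm,
        weightedHomogeneousComponent_of_mem (pol2Swap_mem_gr hm e)]
      split_ifs
      · rfl
      · exact map_zero _
    | add f g hf hg => rw [map_add, map_add, hf, hg, map_add, map_add]
  rw [h, hf e]

theorem nh2Proj_mem_ideal {k : Type u} [Field k] (d : ℤ) (ξ : NH2 k) (h : ξ ∈ nh2Ideal k) :
    nh2Proj k d ξ ∈ nh2Ideal k := by
  refine nh2Ideal_induction (P := fun ξ => nh2Proj k d ξ ∈ nh2Ideal k) ?_ ?_ ?_ h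
  · rw [map_zero]; exact Ideal.zero_mem _
  · intro ξ ξ' h1 h2
    rw [map_add]; exact Ideal.add_mem _ h1 h2
  · intro ξ e he
    have hξ : ξ ∈ ⨆ d, nh2Gr k d := by rw [nh2Gr_iSup]; trivial
    refine Submodule.iSup_induction _
      (motive := fun ξ => nh2Proj k d (nh2Mul e * ξ) ∈ nh2Ideal k) hξ (fun j η hη => ?_) ?_ ?_
    · have hf := weightedHomogeneousComponent_finsupp (w := fun _ : Fin 2 => (2 : ℤ)) e
      have hs := (finsum_eq_sum _ hf).symm.trans
        (finsum_weightedHomogeneousComponent (fun _ : Fin 2 => (2 : ℤ)) e)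
      rw [← hs, map_sum, Finset.sum_mul, map_sum]
      refine Ideal.sum_mem _ fun m _ => ?_
      have hc : weightedHomogeneousComponent (fun _ : Fin 2 => (2 : ℤ)) m e ∈ sym2Aug k := by
        refine ⟨sym_component he.1 m, ?_⟩
        have h0 := he.2
        rw [constantCoeff_eq] at h0 ⊢
        rw [coeff_weightedHomogeneousComponent, h0, ite_self]
      have hmem := nh2_mul_mem _ _ _ _
        (nh2Mul_mem (weightedHomogeneousComponent_isWeightedHomogeneous m e)) hη
      by_cases hd : m + j = d
      · rw [← hd, nh2Proj_same _ _ hmem]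
        exact mul_mem_nh2Ideal _ hc
      · rw [nh2Proj_ne _ _ hd _ hmem]
        exact Ideal.zero_mem _
    · rw [mul_zero, map_zero]; exact Ideal.zero_mem _
    · intro x y hx hy
      rw [mul_add, map_add]; exact Ideal.add_mem _ hx hy

/-- The quotient algebra `NH₂ / (Sym₂' · NH₂)`. -/
abbrev NH2Quot (k : Type u) [Field k] : Type u := NH2 k ⧸ nh2Ideal k

/-- A `k`-linear endomorphism of `NH₂` that preserves `Sym₂' · NH₂` descends to the quotient. -/
noncomputable def nh2QuotMap {k : Type u} [Field k] (T : NH2 k →ₗ[k] NH2 k)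
    (hT : ∀ ξ ∈ nh2Ideal k, T ξ ∈ nh2Ideal k) : NH2Quot k →ₗ[k] NH2Quot k :=
  ((nh2Ideal k).restrictScalars k).mapQ ((nh2Ideal k).restrictScalars k) T hT

theorem nh2QuotMap_mk {k : Type u} [Field k] (T : NH2 k →ₗ[k] NH2 k)
    (hT : ∀ ξ ∈ nh2Ideal k, T ξ ∈ nh2Ideal k) (ξ : NH2 k) :
    nh2QuotMap T hT (Ideal.Quotient.mkₐ k (nh2Ideal k) ξ) =
      Ideal.Quotient.mkₐ k (nh2Ideal k) (T ξ) := rfl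

/-- The grading of the quotient: images of the graded parts of `NH₂`. -/
noncomputable def nh2QuotGr (k : Type u) [Field k] (d : ℤ) : Submodule k (NH2Quot k) :=
  (nh2Gr k d).map (Ideal.Quotient.mkₐ k (nh2Ideal k)).toLinearMap

/-- The `p`-DG algebra `NH₂ / (Sym₂' · NH₂)` with the grading and the differential induced from
`(NH₂, ∂_a)`. -/
noncomputable def nh2QuotPDG (p : ℕ) [Fact p.Prime] (k : Type u) [Field k] [CharP k p]
    (a : ZMod p) : PDGAlgebra p k where
  carrier := NH2Quot k
  gr := nh2QuotGr k
  isInternal := by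
    refine isInternal_of_proj _ (fun d => nh2QuotMap (nh2Proj k d) (nh2Proj_mem_ideal d)) ?_ ?_ ?_
    · rintro i _ ⟨ξ, hξ, rfl⟩
      exact congrArg _ (nh2Proj_same i ξ hξ)
    · rintro i j hij _ ⟨ξ, hξ, rfl⟩
      exact (congrArg (Ideal.Quotient.mkₐ k (nh2Ideal k)) (nh2Proj_ne i j hij ξ hξ)).trans
        (map_zero _)
    · change ⨆ i, (nh2Gr k i).map (Ideal.Quotient.mkₐ k (nh2Ideal k)).toLinearMap = ⊤
      rw [← Submodule.map_iSup, nh2Gr_iSup, Submodule.map_top, LinearMap.range_eq_top]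
      exact Ideal.Quotient.mkₐ_surjective k (nh2Ideal k)
  one_mem := ⟨1, (nh2PDG p k a).one_mem, map_one (Ideal.Quotient.mkₐ k (nh2Ideal k))⟩
  mul_mem := by
    rintro i j _ _ ⟨ξ, hξ, rfl⟩ ⟨η, hη, rfl⟩
    exact ⟨ξ * η, nh2_mul_mem i j ξ η hξ hη, map_mul (Ideal.Quotient.mkₐ k (nh2Ideal k)) ξ η⟩
  d := nh2QuotMap (nh2Diff a) (nh2Diff_mem_ideal a)
  d_mem := by
    rintro i _ ⟨ξ, hξ, rfl⟩
    exact ⟨nh2Diff a ξ, nh2Diff_mem a i ξ hξ, rfl⟩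
  leibniz := by
    intro x y
    obtain ⟨ξ, rfl⟩ := Ideal.Quotient.mkₐ_surjective k (nh2Ideal k) x
    obtain ⟨η, rfl⟩ := Ideal.Quotient.mkₐ_surjective k (nh2Ideal k) y
    rw [← map_mul, nh2QuotMap_mk, nh2QuotMap_mk, nh2QuotMap_mk, nh2Diff_leibniz, map_add, map_mul,
      map_mul]
  d_pow := by
    have h : ∀ (n : ℕ) (ξ : NH2 k), (nh2QuotMap (nh2Diff a) (nh2Diff_mem_ideal a) ^ n)
        (Ideal.Quotient.mkₐ k (nh2Ideal k) ξ) =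
          Ideal.Quotient.mkₐ k (nh2Ideal k) ((nh2Diff a ^ n) ξ) := by
      intro n ξ
      induction n with
      | zero => rfl
      | succ n ih =>
        rw [pow_succ', Module.End.mul_apply, ih, nh2QuotMap_mk, pow_succ', Module.End.mul_apply]
    refine LinearMap.ext fun x => ?_
    obtain ⟨ξ, rfl⟩ := Ideal.Quotient.mkₐ_surjective k (nh2Ideal k) x
    rw [h, nh2Diff_pow]
    exact map_zero _

/-- The canonical projection `π₂ : (NH₂, ∂_a) → NH₂ / (Sym₂' · NH₂)` of `p`-DG algebras. -/
noncomputable def nh2Pi (p : ℕ) [Fact p.Prime] (k : Type u) [Field k] [CharP k p] (a : ZMod p) :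
    PDGAlgebraHom (nh2PDG p k a) (nh2QuotPDG p k a) where
  toAlgHom := Ideal.Quotient.mkₐ k (nh2Ideal k)
  map_mem := fun _ ξ hξ => ⟨ξ, hξ, rfl⟩
  comm := fun _ => rfl

end NilHecke

/-! ## Iterated commutators in characteristic `p` -/

/-! Since `1`, `x_i` is a basis of `k[x₁, x₂]` over the symmetric polynomials, evaluation at `1` and
`x_i` identifies `NH₂` with two copies of `k[x₁, x₂]`. Reducing both values modulo `Sym₂'`, in the
basis `1`, `x_i`, leaves four scalars; they are the entries of a matrix (`nh2ToMatrix`), whence the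
isomorphism with `M(2, k)`.

Let `a = ±1`. As `∂_a` depends only on `α₂ - α₁`, it is induced by a twist `D` of the polynomial
differential by `-x_i`. This `D` sends `1` to `-x_i` and kills `x_i`, so the span of `1` and `x_i`
is stable, and an operator on `k[x₁, x₂]`, applied to both values, gives an operator on `NH₂`
compatibly with commutators (`innerDer_nh2Post`). In characteristic `p` the null-homotopic maps are
the iterated commutators `ad(∂)^(p-1)(h)` (`innerDer_pow_char_sub_one`), so it suffices to contract
`k[x₁, x₂]` onto the span of `1` and `x_i`. In one variable the twisted differential is `x^m ↦ (m -
r) x^(m+1)`, with `r = 1` for `x_i` and `r = 0` for the other variable. It splits into the short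
chain `1, ..., x^r` and chains of length `p`, and the latter are contractible (`innerDer_pol2Htpy`).

Conversely, suppose `π₂` has a homotopy inverse `g`. For degree reasons, if `∂^n` kills the class of
`δ` in the quotient for some `n ≤ p - 1`, then `∂^n δ = 0` already in `NH₂`
(`nh2Diff_pow_delta_eq_zero`). In the quotient `∂³ δ = 0` always, and `∂ δ = 0` if `a = 0`. But the
coefficient of `x₁^n δ` in `∂^n δ` is `∏_{l<n} (l - a - 1)`. For `a ≠ 0` and `p ≥ 5` its vanishing
at `n = 3` leaves `a = ±1`; for `a = 0` its value at `n = 1` is `-1`; for `p = 2, 3` every nonzero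
`a` is `±1`. -/

/-- The inner derivation `T ↦ X T - T X` of an algebra. -/
noncomputable def innerDer (k : Type*) [Field k] {A : Type*} [Ring A] [Algebra k A] (X : A) :
    Module.End k A :=
  LinearMap.mulLeft k X - LinearMap.mulRight k X

section InnerDer

variable {k : Type*} [Field k] {A : Type*} [Ring A] [Algebra k A]

theorem innerDer_apply (X T : A) : innerDer k X T = X * T - T * X := rfl

/-- Pascal's rule writes the sum of two neighbouring coefficients of row `p - 1` as a coefficient of
row `p`, which vanishes modulo `p`; hence row `p - 1` alternates in sign. -/
theorem neg_one_pow_mul_choose_char {p : ℕ} [Fact p.Prime] (R : Type*) [CommRing R] [CharP R p]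
    {t : ℕ} (ht : t < p) : (-1 : R) ^ t * ((p - 1).choose t : R) = 1 := by
  induction t with
  | zero => simp
  | succ t ih =>
    have hp : 0 < p := by omega
    have h := Nat.choose_succ_succ (p - 1) t
    have hd : (p.choose (t + 1) : R) = 0 :=
      (CharP.cast_eq_zero_iff R p _).2 (Fact.out (p := p.Prime) |>.dvd_choose_self (by omega) ht)
    rw [Nat.succ_eq_add_one, Nat.succ_eq_add_one, Nat.sub_add_cancel hp] at h
    rw [h] at hd
    push_cast at hd
    have := ih (by omega)
    rw [pow_succ]
    linear_combination this - (-1) ^ t * hd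

/-- Left and right multiplication by `X` commute, so the binomial theorem applies, and the signed
coefficients of row `p - 1` all equal `1`. With `X` a differential and `T` a homotopy, the right
side is the sum in the definition of a null-homotopic map. -/
theorem innerDer_pow_char_sub_one {p : ℕ} [Fact p.Prime] [CharP k p] (X T : A) :
    (innerDer k X ^ (p - 1)) T =
      ∑ j ∈ Finset.range p, X ^ (p - 1 - j) * T * X ^ j := by
  have hp : p - 1 + 1 = p := Nat.sub_add_cancel (Fact.out (p := p.Prime)).one_le
  have hc : Commute (LinearMap.mulRight k (-X)) (LinearMap.mulLeft k X) :=
    (LinearMap.commute_mulLeft_right _ _).symm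
  have hX : innerDer k X = LinearMap.mulRight k (-X) + LinearMap.mulLeft k X := by
    ext T
    simp [innerDer_apply]
    abel
  rw [hX, hc.add_pow, LinearMap.sum_apply, hp]
  refine Finset.sum_congr rfl fun j hj => ?_
  have h1 := neg_one_pow_mul_choose_char k (Finset.mem_range.1 hj)
  have h2 : (-X) ^ j = (-1 : k) ^ j • X ^ j := by
    rw [← neg_one_smul k X, smul_pow]
  rw [LinearMap.pow_mulRight, LinearMap.pow_mulLeft, Module.End.mul_apply, Module.End.mul_apply,
    Module.End.natCast_apply, ← Nat.cast_smul_eq_nsmul k, LinearMap.mulLeft_apply,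
    LinearMap.mulRight_apply, h2, mul_smul_comm, mul_smul_comm, smul_mul_assoc, smul_smul, h1,
    one_smul]

/-- A summand commuting with everything in sight drops out of the commutator. The second conjunct
keeps the induction going. -/
theorem innerDer_pow_add {X Y T : A} (h : Commute X Y) (hT : Commute Y T) (n : ℕ) :
    (innerDer k (X + Y) ^ n) T = (innerDer k X ^ n) T ∧ Commute Y ((innerDer k X ^ n) T) := by
  induction n with
  | zero => exact ⟨rfl, hT⟩
  | succ n ih =>
    obtain ⟨h1, h2⟩ := ih
    rw [pow_succ', pow_succ', Module.End.mul_apply, Module.End.mul_apply, h1, innerDer_apply,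
      innerDer_apply]
    refine ⟨?_, (h.symm.mul_right h2).sub_right (h2.mul_right h.symm)⟩
    rw [add_mul, mul_add, h2.eq]
    abel

theorem innerDer_pow_mul {X Z : A} (h : Commute Z X) (n : ℕ) (T : A) :
    (innerDer k X ^ n) (Z * T) = Z * (innerDer k X ^ n) T := by
  induction n with
  | zero => rfl
  | succ n ih =>
    rw [pow_succ', Module.End.mul_apply, ih, Module.End.mul_apply, innerDer_apply, innerDer_apply,
      mul_sub, ← mul_assoc, ← h.eq]
    simp only [mul_assoc]

end InnerDer

/-! ### Contracting the one-variable twisted differential -/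

section OneVariable

open MvPolynomial

/-- Wilson's theorem combined with the sign rule for row `p - 1` of Pascal's triangle. It evaluates
the coefficient picked up along a full chain of length `p`. -/
theorem neg_one_pow_mul_factorial_char {p : ℕ} [Fact p.Prime] (k : Type*) [Field k] [CharP k p]
    {t : ℕ} (ht : t < p) :
    (-1 : k) ^ t * ((t.factorial : k) * ((p - 1 - t).factorial : k)) = -1 := by
  have h1 := neg_one_pow_mul_choose_char k ht
  have h2 : (((p - 1).factorial : ℕ) : k) = -1 := by
    have h := congrArg (ZMod.castHom (dvd_refl p) k) (ZMod.wilsons_lemma p)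
    rwa [map_natCast, map_neg, map_one] at h
  rw [← Nat.choose_mul_factorial_mul_factorial (Nat.le_sub_one_of_lt ht)] at h2
  push_cast at h2
  have h3 : ((-1 : k) ^ t) * (-1) ^ t = 1 := by rw [← mul_pow]; simp
  linear_combination h2 + ((t.factorial : k) * ((p - 1 - t).factorial : k)) *
    (((p - 1).choose t : k) * h3 - (-1 : k) ^ t * h1)

/-- On monomials, `x_i^m ↦ -x_i^(m+1-p)` if `m ≡ r` modulo `p` and `m ≥ p`, and `0` otherwise. -/
noncomputable def pol2Htpy (p : ℕ) (k : Type u) [Field k] (i : Fin 2) (r : ℕ) :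
    Module.End k (Pol2 k) := by
  classical
  exact (basisMonomials (Fin 2) k).constr k fun m =>
    if m i ≡ r [MOD p] ∧ p ≤ m i then -monomial (m - Finsupp.single i (p - 1)) 1 else 0

open Classical in
theorem pol2Htpy_monomial (p : ℕ) {k : Type u} [Field k] (i : Fin 2) (r : ℕ) (m : Fin 2 →₀ ℕ) :
    pol2Htpy p k i r (monomial m 1) = if m i ≡ r [MOD p] ∧ p ≤ m i then
      -monomial (m - Finsupp.single i (p - 1)) 1 else 0 := by
  have := (basisMonomials (Fin 2) k).constr_basis k (fun m =>
    if m i ≡ r [MOD p] ∧ p ≤ m i then -monomial (m - Finsupp.single i (p - 1)) (1 : k) else 0) m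
  rwa [coe_basisMonomials] at this

/-- The projection to the span of the monomials of degree at most `r` in `x_i`. -/
noncomputable def pol2Trunc (k : Type u) [Field k] (i : Fin 2) (r : ℕ) :
    Module.End k (Pol2 k) :=
  (basisMonomials (Fin 2) k).constr k fun m => if m i ≤ r then monomial m 1 else 0

theorem pol2Trunc_monomial {k : Type u} [Field k] (i : Fin 2) (r : ℕ) (m : Fin 2 →₀ ℕ) :
    pol2Trunc k i r (monomial m 1) = if m i ≤ r then monomial m 1 else 0 := by
  have := (basisMonomials (Fin 2) k).constr_basis k (fun m =>
    if m i ≤ r then monomial m (1 : k) else 0) m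
  rwa [coe_basisMonomials] at this

theorem pol2_end_ext {k : Type u} [Field k] {S T : Module.End k (Pol2 k)}
    (h : ∀ m : Fin 2 →₀ ℕ, S (monomial m 1) = T (monomial m 1)) : S = T :=
  MvPolynomial.linearMap_ext fun m => LinearMap.ext_ring (h m)

theorem prod_range_sub_char {k : Type*} [Field k] (t : ℕ) :
    ∏ l ∈ Finset.range t, ((l : k) - t) = (-1) ^ t * (t.factorial : k) := by
  rw [← Finset.prod_range_reflect]
  have : ∀ l ∈ Finset.range t, (((t - 1 - l : ℕ) : k) - t) = (-1) * ((l + 1 : ℕ) : k) := by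
    intro l hl
    have h := Finset.mem_range.1 hl
    rw [Nat.sub_sub, Nat.cast_sub (by omega)]
    push_cast
    ring
  rw [Finset.prod_congr rfl this, Finset.prod_mul_distrib, Finset.prod_const, Finset.card_range,
    ← Nat.cast_prod, Finset.prod_range_add_one_eq_factorial]

/-- The operator is `x^m ↦ (m - r) x^(m+1)` in the variable `x_i`, so chains break exactly after
exponents congruent to `r`. Beyond the initial chain `1, ..., x^r` every chain has length `p`, and
the homotopy sends its top to minus its bottom. Going up to the top, down to the bottom and back up
to the start multiplies a monomial by `1`. -/
theorem innerDer_pol2Htpy {p : ℕ} [Fact p.Prime] {k : Type u} [Field k] [CharP k p] (i : Fin 2)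
    {r : ℕ} (hr : r < p) :
    (innerDer k (pol2Part i (-(r : k)) : Module.End k (Pol2 k)) ^ (p - 1)) (pol2Htpy p k i r) =
      1 - pol2Trunc k i r := by
  classical
  have hp : 0 < p := (Fact.out (p := p.Prime)).pos
  have hpk : (p : k) = 0 := CharP.cast_eq_zero k p
  rw [innerDer_pow_char_sub_one]
  refine pol2_end_ext fun m => ?_
  rw [LinearMap.sum_apply, LinearMap.sub_apply, Module.End.one_apply, pol2Trunc_monomial]
  have key : ∀ j, (pol2Part i (-(r : k)) ^ (p - 1 - j) * pol2Htpy p k i r *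
      pol2Part i (-(r : k)) ^ j) (monomial m 1) =
      (∏ l ∈ Finset.range j, ((m i : k) + -(r : k) + l)) • (pol2Part i (-(r : k)) ^ (p - 1 - j))
        (if m i + j ≡ r [MOD p] ∧ p ≤ m i + j then
          -monomial (m + Finsupp.single i j - Finsupp.single i (p - 1)) 1 else 0) := by
    intro j
    rw [Module.End.mul_apply, Module.End.mul_apply, pol2Part_pow_monomial, map_smul, map_smul,
      pol2Htpy_monomial, Finsupp.add_apply, Finsupp.single_eq_same]
  simp only [key]
  -- The number `t` of steps from `m i` to the top of its chain is the residue of `r - m i`, written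
  -- with `p - 1` for `-1` to stay in the natural numbers.
  obtain ⟨t, htp, ht⟩ : ∃ t < p, m i + t ≡ r [MOD p] := by
    refine ⟨(r + (p - 1) * m i) % p, Nat.mod_lt _ hp, ?_⟩
    have h1 : m i + (r + (p - 1) * m i) = r + p * m i := by
      obtain ⟨q, rfl⟩ : ∃ q, p = q + 1 := ⟨p - 1, by omega⟩
      rw [Nat.add_sub_cancel]
      ring
    refine ((Nat.mod_modEq _ p).add_left (m i)).trans ?_
    rw [h1]
    simp [Nat.ModEq]
  -- The homotopy is nonzero only at tops of chains, so only the term that climbs exactly `t` steps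
  -- can contribute.
  rw [Finset.sum_eq_single_of_mem t (Finset.mem_range.2 htp)]
  -- In the initial chain the top is `x^r` itself, with `r < p`, where the homotopy vanishes.
  · by_cases hm : m i ≤ r
    · have : ¬ p ≤ m i + t := by
        intro h
        have h1 : m i + t - p ≡ r [MOD p] := by
          refine Nat.ModEq.trans ?_ ht
          conv_rhs => rw [← Nat.sub_add_cancel h]
          simp [Nat.ModEq]
        have h2 := Nat.ModEq.eq_of_lt_of_lt h1 (by omega) hr
        omega
      simp [hm, this]
    · have hge : p ≤ m i + t := by
        by_contra h
        have h2 := Nat.ModEq.eq_of_lt_of_lt ht (by omega) hr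
        omega
      have hk : (m i : k) + t = r := by
        have := (CharP.natCast_eq_natCast k p).2 ht
        push_cast at this
        exact this
      rw [if_pos ⟨ht, hge⟩, if_neg hm, sub_zero, map_neg, pol2Part_pow_monomial]
      have hexp : m + Finsupp.single i t - Finsupp.single i (p - 1) +
          Finsupp.single i (p - 1 - t) = m := by
        ext l
        by_cases hl : l = i
        · subst hl
          simp
          omega
        · simp [Ne.symm hl]
      -- The climb to the top contributes `(-1)^t t!`; the climb from the bottom back to the start
      -- contributes `(p - 1 - t)!`.
      have h1 : ∏ l ∈ Finset.range t, ((m i : k) + -(r : k) + l) =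
          (-1) ^ t * (t.factorial : k) := by
        rw [← prod_range_sub_char]
        refine Finset.prod_congr rfl fun l _ => ?_
        rw [← hk]
        ring
      have h2 : ∏ l ∈ Finset.range (p - 1 - t),
          (((m + Finsupp.single i t - Finsupp.single i (p - 1)) i : ℕ) + -(r : k) + (l : k)) =
            ((p - 1 - t).factorial : k) := by
        rw [← Finset.prod_range_add_one_eq_factorial, Nat.cast_prod]
        refine Finset.prod_congr rfl fun l _ => ?_
        simp only [Finsupp.tsub_apply, Finsupp.add_apply, Finsupp.single_eq_same]
        rw [Nat.cast_sub (by omega), Nat.cast_sub (by omega), ← hk]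
        push_cast [Nat.cast_sub hp, hpk]
        ring
      rw [hexp, h1, h2, ← smul_neg, smul_smul, smul_neg, ← neg_smul, mul_assoc,
        neg_one_pow_mul_factorial_char k htp, neg_neg, one_smul]
  · intro j hj hne
    rw [if_neg, map_zero, smul_zero]
    rintro ⟨h, -⟩
    exact hne (Nat.ModEq.eq_of_lt_of_lt
      (Nat.ModEq.add_left_cancel' (m i) (h.trans ht.symm)) (Finset.mem_range.1 hj) htp)

end OneVariable

/-! ### Combining the contractions in both variables -/

section TwoVariables

open MvPolynomial

theorem pol2Part_commute_htpy (p : ℕ) {k : Type u} [Field k] {i j : Fin 2} (hij : i ≠ j) (c : k)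
    (r : ℕ) : Commute (pol2Part j c) (pol2Htpy p k i r) := by
  classical
  refine pol2_end_ext fun m => ?_
  rw [Module.End.mul_apply, Module.End.mul_apply, pol2Part_monomial, map_smul, pol2Htpy_monomial,
    pol2Htpy_monomial]
  have h1 : (m + Finsupp.single j 1 : Fin 2 →₀ ℕ) i = m i := by simp [hij]
  rw [h1]
  split_ifs with h
  · have h2 : m + Finsupp.single j 1 - Finsupp.single i (p - 1) =
        m - Finsupp.single i (p - 1) + Finsupp.single j 1 := by
      ext l
      by_cases hl : l = i
      · subst hl
        simp [hij]
      · simp [Ne.symm hl]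
    have h3 : (m - Finsupp.single i (p - 1)) j = m j := by simp [hij]
    rw [map_neg, pol2Part_monomial, h2, h3, smul_neg]
  · rw [map_zero, smul_zero]

theorem pol2Trunc_commute_part {k : Type u} [Field k] {i j : Fin 2} (hij : i ≠ j) (c : k)
    (r : ℕ) : Commute (pol2Trunc k i r) (pol2Part j c) := by
  refine pol2_end_ext fun m => ?_
  rw [Module.End.mul_apply, Module.End.mul_apply, pol2Part_monomial, map_smul, pol2Trunc_monomial,
    pol2Trunc_monomial]
  have h1 : (m + Finsupp.single j 1 : Fin 2 →₀ ℕ) i = m i := by simp [hij]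
  rw [h1]
  split_ifs with h
  · rw [pol2Part_monomial]
  · rw [map_zero, smul_zero]

/-- The only arrow crossing the cut goes from exponent `r` to `r + 1`, and its coefficient is `r - r
= 0`. -/
theorem pol2Trunc_commute_part_self {k : Type u} [Field k] (i : Fin 2) (r : ℕ) :
    Commute (pol2Trunc k i r) (pol2Part i (-(r : k))) := by
  refine pol2_end_ext fun m => ?_
  rw [Module.End.mul_apply, Module.End.mul_apply, pol2Part_monomial, map_smul, pol2Trunc_monomial,
    pol2Trunc_monomial]
  rw [Finsupp.add_apply, Finsupp.single_eq_same]
  rcases lt_trichotomy (m i) r with h | h | h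
  · rw [if_pos (by omega), if_pos h.le, pol2Part_monomial]
  · rw [if_pos h.le, pol2Part_monomial, h, add_neg_cancel, zero_smul, zero_smul]
  · rw [if_neg (by omega), if_neg (by omega), map_zero, smul_zero]

theorem pol2Diff_single {p : ℕ} {k : Type u} [Field k] [CharP k p] (i : Fin 2) (f : Pol2 k) :
    pol2Diff (Pi.single i (-1) : Fin 2 → ZMod p) f = pol2Der k f - X i * f := by
  rw [pol2Diff_apply, Fin.sum_univ_two]
  fin_cases i <;> simp <;> ring

/-- The natural numbers `1` and `0` are kept as casts because they play the role of `r` in the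
one-variable contraction. -/
theorem pol2Diff_single_eq {p : ℕ} {k : Type u} [Field k] [CharP k p] {i j : Fin 2} (hij : i ≠ j) :
    (pol2Diff (Pi.single i (-1) : Fin 2 → ZMod p) : Module.End k (Pol2 k)) =
      pol2Part i (-((1 : ℕ) : k)) + pol2Part j (-((0 : ℕ) : k)) := by
  rw [pol2Diff_eq]
  fin_cases i <;> fin_cases j <;> simp at hij ⊢
  rw [add_comm]

theorem pol2Part_comm' {k : Type u} [Field k] {i j : Fin 2} (hij : i ≠ j) (c c' : k) :
    Commute (pol2Part i c) (pol2Part j c') := by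
  fin_cases i <;> fin_cases j <;> simp at hij ⊢
  · exact pol2Part_comm _ _
  · exact (pol2Part_comm _ _).symm

/-- A contracting homotopy of `k[x₁, x₂]` onto the span of `1` and `x_i`, for the twist of the
differential by `-x_i`. -/
noncomputable def pol2TwistHtpy (p : ℕ) (k : Type u) [Field k] (i j : Fin 2) :
    Module.End k (Pol2 k) :=
  pol2Htpy p k i 1 + pol2Trunc k i 1 * pol2Htpy p k j 0

/-- Contract in `x_i` first, then contract in `x_j` what the truncation in `x_i` keeps: `(1 - P) + P
(1 - Q) = 1 - P Q` for the two truncations `P` and `Q`. -/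
theorem innerDer_pol2TwistHtpy {p : ℕ} [Fact p.Prime] {k : Type u} [Field k] [CharP k p]
    {i j : Fin 2} (hij : i ≠ j) :
    (innerDer k (pol2Diff (Pi.single i (-1) : Fin 2 → ZMod p) : Module.End k (Pol2 k)) ^ (p - 1))
      (pol2TwistHtpy p k i j) = 1 - pol2Trunc k i 1 * pol2Trunc k j 0 := by
  have hp := (Fact.out (p := p.Prime)).two_le
  rw [pol2Diff_single_eq hij, pol2TwistHtpy, map_add,
    (innerDer_pow_add (pol2Part_comm' hij _ _) (pol2Part_commute_htpy p hij _ _) _).1,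
    innerDer_pol2Htpy i (by omega), innerDer_pow_mul
      ((pol2Trunc_commute_part_self i 1).add_right (pol2Trunc_commute_part hij _ 1)),
    add_comm (pol2Part i _), (innerDer_pow_add (pol2Part_comm' hij.symm _ _)
      (pol2Part_commute_htpy p hij.symm _ _) _).1, innerDer_pol2Htpy j (by omega), mul_sub, mul_one,
    sub_add_sub_cancel]

theorem weight_two {m : Fin 2 →₀ ℕ} :
    Finsupp.weight (fun _ : Fin 2 => (2 : ℤ)) m = 2 * (m 0 : ℤ) + 2 * (m 1 : ℤ) := by
  rw [Finsupp.weight_apply, Finsupp.sum_fintype _ _ (by simp), Fin.sum_univ_two]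
  simp [mul_comm]

/-- A linear endomorphism of `k[x₁, x₂]` has degree `d` if it shifts the degree of monomials
by `d`. -/
theorem pol2_map_mem_gr {k : Type u} [Field k] {T : Module.End k (Pol2 k)} {d : ℤ}
    (h : ∀ m : Fin 2 →₀ ℕ, T (monomial m 1) ∈
      pol2Gr k (Finsupp.weight (fun _ : Fin 2 => (2 : ℤ)) m + d)) {n : ℤ} {f : Pol2 k}
    (hf : f ∈ pol2Gr k n) : T f ∈ pol2Gr k (n + d) := by
  refine IsWeightedHomogeneous.induction_on (motive := fun f _ => T f ∈ pol2Gr k (n + d))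
    ?_ ?_ ?_ hf
  · rw [map_zero]; exact Submodule.zero_mem _
  · intro f g _ _ h1 h2
    rw [map_add]; exact Submodule.add_mem _ h1 h2
  · intro m r hm
    rw [← mul_one r, ← smul_eq_mul, ← smul_monomial, map_smul, ← hm]
    exact Submodule.smul_mem _ _ (h m)

theorem pol2Htpy_mem_gr {p : ℕ} (hp : 0 < p) {k : Type u} [Field k] (i : Fin 2) (r : ℕ) {n : ℤ}
    {f : Pol2 k} (hf : f ∈ pol2Gr k n) : pol2Htpy p k i r f ∈ pol2Gr k (n + (2 - 2 * (p : ℤ))) := by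
  classical
  refine pol2_map_mem_gr (fun m => ?_) hf
  rw [pol2Htpy_monomial]
  split_ifs with h
  · refine Submodule.neg_mem _ (isWeightedHomogeneous_monomial _ _ _ ?_)
    rw [weight_two, weight_two]
    fin_cases i <;> simp at h ⊢ <;> omega
  · exact Submodule.zero_mem _

theorem pol2Trunc_mem_gr {k : Type u} [Field k] (i : Fin 2) (r : ℕ) {n : ℤ}
    {f : Pol2 k} (hf : f ∈ pol2Gr k n) : pol2Trunc k i r f ∈ pol2Gr k n := by
  rw [← add_zero n]
  refine pol2_map_mem_gr (fun m => ?_) hf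
  rw [pol2Trunc_monomial, add_zero]
  split_ifs with h
  · exact isWeightedHomogeneous_monomial _ _ _ rfl
  · exact Submodule.zero_mem _

theorem pol2TwistHtpy_mem_gr {p : ℕ} (hp : 0 < p) {k : Type u} [Field k] (i j : Fin 2) {n : ℤ}
    {f : Pol2 k} (hf : f ∈ pol2Gr k n) :
    pol2TwistHtpy p k i j f ∈ pol2Gr k (n + (2 - 2 * (p : ℤ))) :=
  Submodule.add_mem _ (pol2Htpy_mem_gr hp i 1 hf)
    (pol2Trunc_mem_gr i 1 (pol2Htpy_mem_gr hp j 0 hf))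

end TwoVariables

/-! ### `NH₂` as pairs of polynomials, the values at `1` and `x_i` -/

section Pairs

open MvPolynomial

theorem pol2_sum_mem_sym (k : Type u) [Field k] : (X 0 + X 1 : Pol2 k) ∈ Sym2Pol k := by
  have h := esymm_isSymmetric (Fin 2) k 1
  rw [esymm_one, Fin.sum_univ_two] at h
  exact h

theorem pol2_prod_mem_sym (k : Type u) [Field k] : (X 0 * X 1 : Pol2 k) ∈ Sym2Pol k := fun e => by
  rw [map_mul, rename_X, rename_X]
  rw [← Fin.prod_univ_two (fun i => (X i : Pol2 k)), ← Equiv.prod_comp e, Fin.prod_univ_two]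

theorem nh2_map_sym_mul {k : Type u} [Field k] (ξ : NH2 k) {e : Pol2 k} (he : e ∈ Sym2Pol k)
    (f : Pol2 k) : ξ (e * f) = e * ξ f :=
  ξ.map_smul (⟨e, he⟩ : Sym2Pol k) f

theorem nh2_map_smul {k : Type u} [Field k] (ξ : NH2 k) (c : k) (f : Pol2 k) :
    ξ (c • f) = c • ξ f :=
  LinearMap.map_smul_of_tower ξ c f

theorem pol2_eq_sym_at {k : Type u} [Field k] (i : Fin 2) (f : Pol2 k) :
    ∃ u ∈ Sym2Pol k, ∃ v ∈ Sym2Pol k, f = u + v * X i := by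
  obtain ⟨u, v, h⟩ := pol2_eq_sym k f
  simp only [Subalgebra.smul_def, smul_eq_mul, mul_one] at h
  fin_cases i
  · exact ⟨u, u.2, v, v.2, h⟩
  · refine ⟨(u : Pol2 k) + (X 0 + X 1) * (v : Pol2 k), add_mem u.2 (mul_mem (pol2_sum_mem_sym k) v.2), -(v : Pol2 k),
      neg_mem v.2, ?_⟩
    rw [h]
    simp only [Fin.mk_one]
    ring

/-- The divided difference, normalised by `1 ↦ 0` and `x_i ↦ 1`. -/
noncomputable def nh2DeltaAt (k : Type u) [Field k] (i : Fin 2) : NH2 k :=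
  if i = 0 then nh2Delta k else -nh2Delta k

theorem nh2DeltaAt_one {k : Type u} [Field k] (i : Fin 2) : nh2DeltaAt k i 1 = 0 := by
  unfold nh2DeltaAt
  split_ifs <;> simp [nh2Delta_one]

theorem nh2DeltaAt_X {k : Type u} [Field k] (i : Fin 2) : nh2DeltaAt k i (X i) = 1 := by
  have hY : nh2Delta k (X 1) = -1 := by
    refine mul_left_cancel₀ pol2_sub_ne_zero ?_
    rw [nh2Delta_spec, pol2Swap_X1]
    ring
  fin_cases i <;> simp [nh2DeltaAt, nh2Delta_X, hY]

theorem nh2DeltaAt_mem (k : Type u) [Field k] (i : Fin 2) : nh2DeltaAt k i ∈ nh2Gr k (-2) := by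
  unfold nh2DeltaAt
  split_ifs
  · exact nh2Delta_mem k
  · exact Submodule.neg_mem _ (nh2Delta_mem k)

theorem nh2DeltaAt_sym {k : Type u} [Field k] (i : Fin 2) {u v : Pol2 k} (hu : u ∈ Sym2Pol k)
    (hv : v ∈ Sym2Pol k) : nh2DeltaAt k i (u + v * X i) = v := by
  rw [map_add, nh2_map_sym_mul _ hv, nh2DeltaAt_X, ← mul_one u, nh2_map_sym_mul _ hu,
    nh2DeltaAt_one]
  ring

theorem nh2_ext_at {k : Type u} [Field k] (i : Fin 2) {ξ η : NH2 k} (h1 : ξ 1 = η 1)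
    (h2 : ξ (X i) = η (X i)) : ξ = η := by
  ext1 f
  obtain ⟨u, hu, v, hv, rfl⟩ := pol2_eq_sym_at i f
  rw [← mul_one u]
  simp only [map_add, nh2_map_sym_mul _ hu, nh2_map_sym_mul _ hv, h1, h2]

/-- The element of `NH₂` with values `f₀` at `1` and `f₁` at `x_i`. -/
noncomputable def nh2Pair {k : Type u} [Field k] (i : Fin 2) (f₀ f₁ : Pol2 k) : NH2 k :=
  nh2Mul f₀ + nh2Mul (f₁ - X i * f₀) * nh2DeltaAt k i

theorem nh2Pair_one {k : Type u} [Field k] (i : Fin 2) (f₀ f₁ : Pol2 k) :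
    nh2Pair i f₀ f₁ 1 = f₀ := by
  simp [nh2Pair, nh2Mul_apply, nh2DeltaAt_one]

theorem nh2Pair_X {k : Type u} [Field k] (i : Fin 2) (f₀ f₁ : Pol2 k) :
    nh2Pair i f₀ f₁ (X i) = f₁ := by
  simp [nh2Pair, nh2Mul_apply, nh2DeltaAt_X]
  ring

theorem nh2Pair_mem {k : Type u} [Field k] (i : Fin 2) {f₀ f₁ : Pol2 k} {d : ℤ}
    (h0 : f₀ ∈ pol2Gr k d) (h1 : f₁ ∈ pol2Gr k (d + 2)) : nh2Pair i f₀ f₁ ∈ nh2Gr k d := by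
  refine Submodule.add_mem _ (nh2Mul_mem h0) ?_
  have h2 : X i * f₀ ∈ pol2Gr k (d + 2) := by
    rw [add_comm]
    exact IsWeightedHomogeneous.mul (isWeightedHomogeneous_X k _ i) h0
  have := nh2_mul_mem _ _ _ _ (nh2Mul_mem (Submodule.sub_mem _ h1 h2)) (nh2DeltaAt_mem k i)
  rwa [add_neg_cancel_right] at this

theorem nh2_apply_one_mem {k : Type u} [Field k] {ξ : NH2 k} {d : ℤ} (h : ξ ∈ nh2Gr k d) :
    ξ 1 ∈ pol2Gr k d :=
  (nh2_mem_coeff h).1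

theorem nh2_apply_X_mem {k : Type u} [Field k] {ξ : NH2 k} {d : ℤ} (h : ξ ∈ nh2Gr k d)
    (i : Fin 2) : ξ (X i) ∈ pol2Gr k (d + 2) := by
  rw [add_comm]
  exact h 2 _ (isWeightedHomogeneous_X k _ i)

/-- The operator on `NH₂` that applies `T` to the values at `1` and `x_i`. -/
noncomputable def nh2Post {k : Type u} [Field k] (i : Fin 2) :
    Module.End k (Pol2 k) →ₗ[k] Module.End k (NH2 k) where
  toFun T :=
    { toFun := fun ξ => nh2Pair i (T (ξ 1)) (T (ξ (X i)))
      map_add' := fun ξ η => nh2_ext_at i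
        (by simp only [LinearMap.add_apply, nh2Pair_one, map_add])
        (by simp only [LinearMap.add_apply, nh2Pair_X, map_add])
      map_smul' := fun c ξ => nh2_ext_at i
        (by simp only [LinearMap.smul_apply, nh2Pair_one, map_smul, RingHom.id_apply])
        (by simp only [LinearMap.smul_apply, nh2Pair_X, map_smul, RingHom.id_apply]) }
  map_add' S T := LinearMap.ext fun _ => nh2_ext_at i
    (by simp [nh2Pair_one]) (by simp [nh2Pair_X])
  map_smul' c T := LinearMap.ext fun _ => nh2_ext_at i
    (by simp [nh2Pair_one]) (by simp [nh2Pair_X])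

theorem nh2Post_apply_one {k : Type u} [Field k] (i : Fin 2) (T : Module.End k (Pol2 k))
    (ξ : NH2 k) : nh2Post i T ξ 1 = T (ξ 1) := nh2Pair_one _ _ _

theorem nh2Post_apply_X {k : Type u} [Field k] (i : Fin 2) (T : Module.End k (Pol2 k))
    (ξ : NH2 k) : nh2Post i T ξ (X i) = T (ξ (X i)) := nh2Pair_X _ _ _

theorem nh2Post_one {k : Type u} [Field k] (i : Fin 2) :
    nh2Post i (1 : Module.End k (Pol2 k)) = 1 :=
  LinearMap.ext fun _ => nh2_ext_at i (nh2Post_apply_one _ _ _) (nh2Post_apply_X _ _ _)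

theorem nh2Post_mem {k : Type u} [Field k] (i : Fin 2) {T : Module.End k (Pol2 k)} {e : ℤ}
    (hT : ∀ (n : ℤ), ∀ f ∈ pol2Gr k n, T f ∈ pol2Gr k (n + e)) {d : ℤ} {ξ : NH2 k}
    (hξ : ξ ∈ nh2Gr k d) : nh2Post i T ξ ∈ nh2Gr k (d + e) := by
  refine nh2Pair_mem i (hT _ _ (nh2_apply_one_mem hξ)) ?_
  rw [add_right_comm]
  exact hT _ _ (nh2_apply_X_mem hξ i)

theorem pol2Diff_single_one {p : ℕ} {k : Type u} [Field k] [CharP k p] (i : Fin 2) :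
    pol2Diff (Pi.single i (-1) : Fin 2 → ZMod p) (1 : Pol2 k) = -X i := by
  rw [pol2Diff_single, Derivation.map_one_eq_zero, mul_one, zero_sub]

theorem pol2Diff_single_X {p : ℕ} {k : Type u} [Field k] [CharP k p] (i : Fin 2) :
    pol2Diff (Pi.single i (-1) : Fin 2 → ZMod p) (X i : Pol2 k) = 0 := by
  rw [pol2Diff_single, pol2Der_X, pow_two, sub_self]

/-- With this twist, `D 1 = -x_i` and `D x_i = 0`, so the derivative of `ξ` has values `D (ξ 1) + ξ
x_i` and `D (ξ x_i)`. The extra term `ξ x_i` passes through `T` by linearity and cancels in the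
commutator. -/
theorem innerDer_nh2Post {p : ℕ} {k : Type u} [Field k] [CharP k p] (i : Fin 2)
    (T : Module.End k (Pol2 k)) :
    innerDer k (nh2DiffOf (Pi.single i (-1) : Fin 2 → ZMod p) : Module.End k (NH2 k))
        (nh2Post i T) =
      nh2Post i (innerDer k (pol2Diff (Pi.single i (-1) : Fin 2 → ZMod p)) T) := by
  refine LinearMap.ext fun ξ => nh2_ext_at i ?_ ?_
  · simp only [innerDer_apply, LinearMap.sub_apply, Module.End.mul_apply, nh2DiffOf_apply,
      nh2Post_apply_one, pol2Diff_single_one, map_neg, nh2Post_apply_X, map_sub]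
    abel
  · simp only [innerDer_apply, LinearMap.sub_apply, Module.End.mul_apply, nh2DiffOf_apply,
      nh2Post_apply_X, pol2Diff_single_X, map_zero, sub_zero]

theorem innerDer_pow_nh2Post {p : ℕ} {k : Type u} [Field k] [CharP k p] (i : Fin 2)
    (T : Module.End k (Pol2 k)) (n : ℕ) :
    (innerDer k (nh2DiffOf (Pi.single i (-1) : Fin 2 → ZMod p) : Module.End k (NH2 k)) ^ n)
        (nh2Post i T) =
      nh2Post i ((innerDer k (pol2Diff (Pi.single i (-1) : Fin 2 → ZMod p)) ^ n) T) := by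
  induction n with
  | zero => rfl
  | succ n ih =>
    rw [pow_succ', Module.End.mul_apply, ih, innerDer_nh2Post, pow_succ', Module.End.mul_apply]

/-! ## The splitting of the augmentation -/

/-- The projection of `k[x₁, x₂]` to the span of `1` and `x_i` along the ideal generated by the
symmetric polynomials without constant term. -/
noncomputable def pol2Aug (k : Type u) [Field k] (i : Fin 2) : Module.End k (Pol2 k) where
  toFun f := C (constantCoeff f) + C (constantCoeff (nh2DeltaAt k i f)) * X i
  map_add' f g := by simp only [map_add]; ring
  map_smul' c f := by
    rw [nh2_map_smul]
    simp only [smul_eq_C_mul, map_mul, constantCoeff_C, RingHom.id_apply]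
    ring

theorem pol2Aug_apply {k : Type u} [Field k] (i : Fin 2) (f : Pol2 k) : pol2Aug k i f =
    C (constantCoeff f) + C (constantCoeff (nh2DeltaAt k i f)) * X i := rfl

theorem pol2Aug_sym_mul {k : Type u} [Field k] (i : Fin 2) {e : Pol2 k} (he : e ∈ sym2Aug k)
    (f : Pol2 k) : pol2Aug k i (e * f) = 0 := by
  have h : constantCoeff e = 0 := he.2
  rw [pol2Aug_apply, nh2_map_sym_mul _ he.1, map_mul, map_mul, h]
  simp [h]

theorem sub_pol2Aug {k : Type u} [Field k] (i : Fin 2) (f : Pol2 k) :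
    ∃ u ∈ sym2Aug k, ∃ v ∈ sym2Aug k, f - pol2Aug k i f = u + v * X i := by
  obtain ⟨u, hu, v, hv, rfl⟩ := pol2_eq_sym_at i f
  refine ⟨u - C (constantCoeff u), ⟨sub_mem hu (Subalgebra.algebraMap_mem _ _), by simp⟩,
    v - C (constantCoeff v), ⟨sub_mem hv (Subalgebra.algebraMap_mem _ _), by simp⟩, ?_⟩
  rw [pol2Aug_apply, nh2DeltaAt_sym i hu hv]
  simp
  ring

/-- For symmetric `u` and `v`, the differential sends `u + v x_i` to `∂u + (∂v - u) x_i`, and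
derivatives have no constant term. Both composites therefore give `-u(0) x_i`. -/
theorem innerDer_pol2Aug {p : ℕ} {k : Type u} [Field k] [CharP k p] (i : Fin 2) :
    innerDer k (pol2Diff (Pi.single i (-1) : Fin 2 → ZMod p)) (pol2Aug k i) = 0 := by
  refine LinearMap.ext fun f => ?_
  obtain ⟨u, hu, v, hv, rfl⟩ := pol2_eq_sym_at i f
  have h1 : pol2Diff (Pi.single i (-1) : Fin 2 → ZMod p) (u + v * X i) =
      pol2Der k u + (pol2Der k v - u) * X i := by
    rw [pol2Diff_single, map_add, Derivation.leibniz, pol2Der_X]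
    simp only [smul_eq_mul]
    ring
  rw [innerDer_apply, LinearMap.sub_apply, Module.End.mul_apply, Module.End.mul_apply, h1,
    pol2Aug_apply, pol2Aug_apply, nh2DeltaAt_sym i hu hv,
    nh2DeltaAt_sym i (pol2Der_mem_sym hu) (sub_mem (pol2Der_mem_sym hv) hu), pol2Diff_single]
  have h2 : ∀ c : k, pol2Der k (C c) = 0 := fun c => derivation_C _ c
  simp only [map_add, map_sub, map_mul, Derivation.leibniz, h2, pol2Der_X, constantCoeff_pol2Der,
    constantCoeff_X, smul_eq_mul, map_zero, LinearMap.zero_apply]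
  ring

theorem pol2Aug_mem_gr {k : Type u} [Field k] (i : Fin 2) {n : ℤ} {f : Pol2 k}
    (hf : f ∈ pol2Gr k n) : pol2Aug k i f ∈ pol2Gr k n := by
  have hc : ∀ (n : ℤ), ∀ f ∈ pol2Gr k n, C (constantCoeff f) ∈ pol2Gr k n := by
    intro n f hf
    by_cases h : constantCoeff f = 0
    · rw [h, map_zero]; exact Submodule.zero_mem _
    -- A homogeneous polynomial with nonzero constant term has degree `0`.
    · have : n = 0 := by
        rw [constantCoeff_eq] at h
        simpa using (hf h).symm
      rw [this]
      exact isWeightedHomogeneous_C _ _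
  refine Submodule.add_mem _ (hc _ _ hf) ?_
  have h := hc _ _ (nh2DeltaAt_mem k i n f hf)
  have := IsWeightedHomogeneous.mul h (isWeightedHomogeneous_X k (fun _ : Fin 2 => (2 : ℤ)) i)
  rwa [neg_add_cancel_right] at this

theorem pol2Aug_eq_self {k : Type u} [Field k] (i : Fin 2) (c d : k) :
    pol2Aug k i (C c + C d * X i) = C c + C d * X i := by
  have h : ∀ c : k, C c ∈ Sym2Pol k := fun c => Subalgebra.algebraMap_mem _ c
  rw [pol2Aug_apply, nh2DeltaAt_sym i (h c) (h d)]
  simp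

/-- The two truncations together leave only the monomials `1` and `x_i`, which the augmentation
fixes. -/
theorem pol2Aug_mul_trunc {k : Type u} [Field k] {i j : Fin 2} (hij : i ≠ j) :
    pol2Aug k i * (pol2Trunc k i 1 * pol2Trunc k j 0) = pol2Trunc k i 1 * pol2Trunc k j 0 := by
  refine pol2_end_ext fun m => ?_
  rw [Module.End.mul_apply, Module.End.mul_apply, pol2Trunc_monomial]
  split_ifs with hj
  · rw [pol2Trunc_monomial]
    split_ifs with hi
    · have hm : m = Finsupp.single i (m i) := by
        ext l
        by_cases hl : l = i
        · subst hl; simp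
        · have : l = j := by omega
          subst this
          simp [Nat.le_zero.1 hj, hij]
      obtain h | h : m i = 0 ∨ m i = 1 := by omega
      · rw [hm, h]
        simpa using pol2Aug_eq_self (k := k) i 1 0
      · rw [hm, h]
        simpa [X] using pol2Aug_eq_self (k := k) i 0 1
    · rw [map_zero]
  · rw [map_zero, map_zero]

theorem nh2Post_aug_ideal {k : Type u} [Field k] (i : Fin 2) {ξ : NH2 k} (h : ξ ∈ nh2Ideal k) :
    nh2Post i (pol2Aug k i) ξ = 0 := by
  refine nh2Ideal_induction (P := fun ξ => nh2Post i (pol2Aug k i) ξ = 0) (map_zero _) ?_ ?_ h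
  · intro ξ η h1 h2
    rw [map_add, h1, h2, add_zero]
  · intro ξ e he
    refine nh2_ext_at i ?_ ?_
    · rw [nh2Post_apply_one, Module.End.mul_apply, nh2Mul_apply, pol2Aug_sym_mul i he]
      rfl
    · rw [nh2Post_apply_X, Module.End.mul_apply, nh2Mul_apply, pol2Aug_sym_mul i he]
      rfl

/-- Together with the vanishing on the ideal, this makes the valuewise augmentation a projection
with kernel exactly `Sym₂' · NH₂`; it is what provides the section of `π₂`. -/
theorem sub_nh2Post_aug_mem_ideal {k : Type u} [Field k] (i : Fin 2) (ξ : NH2 k) :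
    ξ - nh2Post i (pol2Aug k i) ξ ∈ nh2Ideal k := by
  obtain ⟨u, hu, v, hv, h0⟩ := sub_pol2Aug i (ξ 1)
  obtain ⟨u', hu', v', hv', h1⟩ := sub_pol2Aug i (ξ (X i))
  have : ξ - nh2Post i (pol2Aug k i) ξ =
      (nh2Mul u * nh2Pair i 1 0 + nh2Mul v * nh2Pair i (X i) 0) +
        (nh2Mul u' * nh2Pair i 0 1 + nh2Mul v' * nh2Pair i 0 (X i)) := by
    refine nh2_ext_at i ?_ ?_
    · rw [LinearMap.sub_apply, nh2Post_apply_one, h0]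
      simp [nh2Mul_apply, nh2Pair_one]
    · rw [LinearMap.sub_apply, nh2Post_apply_X, h1]
      simp [nh2Mul_apply, nh2Pair_X]
  rw [this]
  exact add_mem (add_mem (mul_mem_nh2Ideal _ hu) (mul_mem_nh2Ideal _ hv))
    (add_mem (mul_mem_nh2Ideal _ hu') (mul_mem_nh2Ideal _ hv'))

end Pairs

section Quotient

open MvPolynomial

/-! ## The quotient is a matrix algebra -/

/-- By symmetric linearity, the constant term of `ξ f` depends only on the class of `f` modulo
`Sym₂'`. Applied to `ξ` and to `δ ξ`, this gives the two rows of the matrix product. -/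
theorem constantCoeff_nh2_apply {k : Type u} [Field k] (ξ : NH2 k) (f : Pol2 k) :
    constantCoeff (ξ f) = constantCoeff (ξ 1) * constantCoeff f +
      constantCoeff (ξ (X 0)) * constantCoeff (nh2DeltaAt k 0 f) := by
  obtain ⟨u, hu, v, hv, rfl⟩ := pol2_eq_sym_at 0 f
  rw [nh2DeltaAt_sym 0 hu hv, map_add, nh2_map_sym_mul _ hv]
  nth_rewrite 1 [← mul_one u]
  rw [nh2_map_sym_mul _ hu]
  simp
  ring

/-- The action of `NH₂` on `k[x₁, x₂] / (Sym₂')`, in the basis `1, x₁`. -/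
noncomputable def nh2ToMatrix (k : Type u) [Field k] : NH2 k →ₐ[k] Matrix (Fin 2) (Fin 2) k :=
  AlgHom.ofLinearMap
    { toFun := fun ξ => !![constantCoeff (ξ 1), constantCoeff (ξ (X 0));
        constantCoeff ((nh2DeltaAt k 0 * ξ) 1), constantCoeff ((nh2DeltaAt k 0 * ξ) (X 0))]
      map_add' := fun ξ η => by ext r s; fin_cases r <;> fin_cases s <;> simp
      map_smul' := fun c ξ => by
        ext r s
        fin_cases r <;> fin_cases s <;> simp [smul_eq_C_mul] }
    (by
      ext r s
      fin_cases r <;> fin_cases s <;> simp [nh2DeltaAt_one, nh2DeltaAt_X])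
    (fun ξ η => by
      change !![_, _; _, _] = !![_, _; _, _] * !![_, _; _, _]
      rw [Matrix.mul_fin_two]
      simp only [← mul_assoc]
      rw [Module.End.mul_apply ξ, Module.End.mul_apply ξ, Module.End.mul_apply (_ * ξ),
        Module.End.mul_apply (_ * ξ), constantCoeff_nh2_apply ξ, constantCoeff_nh2_apply ξ (η (X 0)),
        constantCoeff_nh2_apply (_ * ξ) (η 1), constantCoeff_nh2_apply (_ * ξ) (η (X 0))]
      rfl)

theorem nh2ToMatrix_apply {k : Type u} [Field k] (ξ : NH2 k) : nh2ToMatrix k ξ =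
    !![constantCoeff (ξ 1), constantCoeff (ξ (X 0));
      constantCoeff (nh2DeltaAt k 0 (ξ 1)), constantCoeff (nh2DeltaAt k 0 (ξ (X 0)))] := rfl

theorem nh2ToMatrix_surjective (k : Type u) [Field k] : Function.Surjective (nh2ToMatrix k) := by
  intro A
  have h : ∀ c d : k, nh2DeltaAt k 0 (C c + C d * X 0) = C d := fun c d =>
    nh2DeltaAt_sym 0 (Subalgebra.algebraMap_mem _ c) (Subalgebra.algebraMap_mem _ d)
  refine ⟨nh2Pair 0 (C (A 0 0) + C (A 1 0) * X 0) (C (A 0 1) + C (A 1 1) * X 0), ?_⟩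
  rw [nh2ToMatrix_apply, nh2Pair_one, nh2Pair_X, h, h]
  ext r s
  fin_cases r <;> fin_cases s <;> simp

/-- The matrix entries are the four coefficients of the valuewise augmentation of `ξ`, so the kernel
is the same ideal. -/
theorem nh2ToMatrix_eq_zero_iff {k : Type u} [Field k] (ξ : NH2 k) :
    nh2ToMatrix k ξ = 0 ↔ ξ ∈ nh2Ideal k := by
  constructor
  · intro h
    rw [nh2ToMatrix_apply] at h
    have h00 := congrFun (congrFun h 0) 0
    have h01 := congrFun (congrFun h 0) 1
    have h10 := congrFun (congrFun h 1) 0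
    have h11 := congrFun (congrFun h 1) 1
    simp only [Matrix.of_apply, Matrix.cons_val_zero, Matrix.cons_val_one, Matrix.cons_val',
      Matrix.zero_apply, Matrix.cons_val_fin_one] at h00 h01 h10 h11
    have h0 : nh2Post 0 (pol2Aug k 0) ξ = 0 := by
      refine nh2_ext_at 0 ?_ ?_
      · rw [nh2Post_apply_one, pol2Aug_apply, h00, h10]
        simp
      · rw [nh2Post_apply_X, pol2Aug_apply, h01, h11]
        simp
    have := sub_nh2Post_aug_mem_ideal 0 ξ
    rwa [h0, sub_zero] at this
  · intro h
    refine nh2Ideal_induction (P := fun ξ => nh2ToMatrix k ξ = 0) (map_zero _) ?_ ?_ h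
    · intro ξ η h1 h2
      rw [map_add, h1, h2, add_zero]
    · intro ξ e he
      have h0 : constantCoeff e = 0 := he.2
      have he1 : nh2ToMatrix k (nh2Mul e) = 0 := by
        rw [nh2ToMatrix_apply, nh2Mul_apply, nh2Mul_apply, nh2_map_sym_mul _ he.1,
          nh2_map_sym_mul _ he.1]
        ext r s
        fin_cases r <;> fin_cases s <;> simp [h0]
      rw [map_mul, he1, zero_mul]

theorem nonempty_nh2Quot_algEquiv_matrix (k : Type u) [Field k] :
    Nonempty (NH2Quot k ≃ₐ[k] Matrix (Fin 2) (Fin 2) k) := by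
  refine ⟨(Ideal.quotientEquivAlgOfEq k ?_).trans
    (Ideal.quotientKerAlgEquivOfSurjective (nh2ToMatrix_surjective k))⟩
  ext ξ
  rw [RingHom.mem_ker]
  exact (nh2ToMatrix_eq_zero_iff ξ).symm

/-! ## The projection is a quasi-isomorphism for `a = ±1` -/

/-- The section of `NH₂ → NH₂ / (Sym₂' · NH₂)` induced by `pol2Aug`. -/
noncomputable def nh2Section (k : Type u) [Field k] (i : Fin 2) : NH2Quot k →ₗ[k] NH2 k :=
  ((nh2Ideal k).restrictScalars k).liftQ (nh2Post i (pol2Aug k i)) fun _ h => nh2Post_aug_ideal i h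

theorem nh2Section_mk {k : Type u} [Field k] (i : Fin 2) (ξ : NH2 k) :
    nh2Section k i (Ideal.Quotient.mkₐ k (nh2Ideal k) ξ) = nh2Post i (pol2Aug k i) ξ := rfl

theorem mk_nh2Section {k : Type u} [Field k] (i : Fin 2) (x : NH2Quot k) :
    Ideal.Quotient.mkₐ k (nh2Ideal k) (nh2Section k i x) = x := by
  obtain ⟨ξ, rfl⟩ := Ideal.Quotient.mkₐ_surjective k (nh2Ideal k) x
  rw [nh2Section_mk]
  exact (Ideal.Quotient.eq.2 (sub_nh2Post_aug_mem_ideal i ξ)).symm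

theorem nh2Post_aug_comm {p : ℕ} {k : Type u} [Field k] [CharP k p] (i : Fin 2) (ξ : NH2 k) :
    nh2Post i (pol2Aug k i) (nh2DiffOf (Pi.single i (-1) : Fin 2 → ZMod p) ξ) =
      nh2DiffOf (Pi.single i (-1) : Fin 2 → ZMod p) (nh2Post i (pol2Aug k i) ξ) := by
  have h := innerDer_nh2Post (p := p) i (pol2Aug k i)
  rw [innerDer_pol2Aug, map_zero, innerDer_apply] at h
  exact (sub_eq_zero.1 (LinearMap.congr_fun h ξ)).symm

/-- The truncation onto the span of `1` and `x_i` differs from the augmentation `P`, but `P` fixes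
its image. Since `P - 1` commutes with the differential, multiplying the homotopy by it yields `(P -
1)(1 - truncation) = P - 1`. -/
theorem nh2Post_aug_homotopy {p : ℕ} [Fact p.Prime] {k : Type u} [Field k] [CharP k p]
    {i j : Fin 2} (hij : i ≠ j) :
    nh2Post i (pol2Aug k i) - 1 = ∑ l ∈ Finset.range p,
      (nh2DiffOf (Pi.single i (-1) : Fin 2 → ZMod p) : Module.End k (NH2 k)) ^ (p - 1 - l) *
        nh2Post i ((pol2Aug k i - 1) * pol2TwistHtpy p k i j) *
          (nh2DiffOf (Pi.single i (-1) : Fin 2 → ZMod p) : Module.End k (NH2 k)) ^ l := by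
  have hc : Commute (pol2Aug k i - 1)
      (pol2Diff (Pi.single i (-1) : Fin 2 → ZMod p) : Module.End k (Pol2 k)) := by
    have h := innerDer_pol2Aug (p := p) (k := k) i
    rw [innerDer_apply, sub_eq_zero] at h
    exact (Commute.sub_right (b := pol2Aug k i) h (Commute.one_right _)).symm
  refine Eq.trans ?_ (innerDer_pow_char_sub_one (k := k) (A := Module.End k (NH2 k)) _ _)
  rw [innerDer_pow_nh2Post, innerDer_pow_mul hc,
    innerDer_pol2TwistHtpy hij, mul_sub, mul_one, sub_mul, one_mul, pol2Aug_mul_trunc hij, sub_self,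
    sub_zero, map_sub, nh2Post_one]

theorem nh2Pi_isQuasiIso_of_eq {p : ℕ} [Fact p.Prime] {k : Type u} [Field k] [CharP k p]
    {a : ZMod p} {i j : Fin 2} (hij : i ≠ j)
    (ha : (nh2DiffOf (Pi.single i (-1) : Fin 2 → ZMod p) : NH2 k →ₗ[k] NH2 k) = nh2Diff a) :
    (nh2Pi p k a).IsQuasiIso := by
  have hp : 0 < p := (Fact.out (p := p.Prime)).pos
  have hcomm : ∀ x : NH2Quot k,
      nh2Section k i (nh2QuotMap (nh2Diff a) (nh2Diff_mem_ideal a) x) =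
        nh2Diff a (nh2Section k i x) := by
    intro x
    obtain ⟨ξ, rfl⟩ := Ideal.Quotient.mkₐ_surjective k (nh2Ideal k) x
    rw [nh2QuotMap_mk, nh2Section_mk, nh2Section_mk, ← ha]
    exact nh2Post_aug_comm i ξ
  have hmem : ∀ (d : ℤ) (x : NH2Quot k), x ∈ nh2QuotGr k d → nh2Section k i x ∈ nh2Gr k d := by
    rintro d _ ⟨ξ, hξ, rfl⟩
    change nh2Post i (pol2Aug k i) ξ ∈ nh2Gr k d
    rw [← add_zero d]
    refine nh2Post_mem i (fun n f hf => ?_) hξ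
    rw [add_zero]
    exact pol2Aug_mem_gr i hf
  refine ⟨⟨nh2Section k i, hmem, hcomm⟩,
    ⟨nh2Post i ((pol2Aug k i - 1) * pol2TwistHtpy p k i j), fun d ξ hξ => ?_, ?_⟩,
    -- The section is a strict right inverse of the projection, so the zero homotopy serves on the
    -- quotient.
    ⟨0, fun _ _ _ => Submodule.zero_mem _, ?_⟩⟩
  · refine nh2Post_mem i (fun n f hf => ?_) hξ
    have h := pol2TwistHtpy_mem_gr hp i j hf
    exact Submodule.sub_mem _ (pol2Aug_mem_gr i h) h
  · have h := nh2Post_aug_homotopy (p := p) (k := k) hij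
    rw [ha] at h
    exact h
  · have h1 : (Ideal.Quotient.mkₐ k (nh2Ideal k)).toLinearMap ∘ₗ nh2Section k i = LinearMap.id :=
      LinearMap.ext fun x => mk_nh2Section i x
    refine (sub_eq_zero.2 h1).trans (Finset.sum_eq_zero fun _ _ => ?_).symm
    rw [LinearMap.zero_comp, LinearMap.comp_zero]
    rfl

end Quotient

section Obstruction

open MvPolynomial

/-! ## The projection is not a quasi-isomorphism for `a ≠ ±1` -/

theorem coeff_pol2Part_zero {k : Type u} [Field k] (c : k) (n : ℕ) (g : Pol2 k) :
    coeff (Finsupp.single 0 (n + 1)) (pol2Part 0 c g) = (n + c) * coeff (Finsupp.single 0 n) g := by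
  induction g using MvPolynomial.induction_on' with
  | monomial m r =>
    have h : m + Finsupp.single 0 1 = Finsupp.single 0 (n + 1) ↔ m = Finsupp.single 0 n := by
      rw [Finsupp.single_add, add_left_inj]
    rw [pol2Part_monomial, coeff_smul, coeff_monomial, coeff_monomial, if_congr h rfl rfl]
    split_ifs with hm
    · rw [hm, Finsupp.single_eq_same, smul_eq_mul]
    · simp
  | add f g hf hg => rw [map_add, coeff_add, hf, hg, coeff_add, mul_add]

theorem coeff_pol2Part_one {k : Type u} [Field k] (c : k) (n : ℕ) (g : Pol2 k) :
    coeff (Finsupp.single 0 n) (pol2Part 1 c g) = 0 := by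
  induction g using MvPolynomial.induction_on' with
  | monomial m r =>
    have h : m + Finsupp.single 1 1 ≠ Finsupp.single 0 n := by
      intro h
      have := DFunLike.congr_fun h 1
      simp at this
    rw [pol2Part_monomial, coeff_smul, coeff_monomial, if_neg h, smul_zero]
  | add f g hf hg => rw [map_add, coeff_add, hf, hg, add_zero]

theorem nh2Coeff_apply {k : Type u} [Field k] (ξ : NH2 k) :
    nh2Coeff k ξ = ξ (X 0) - X 0 * ξ 1 := rfl

/-- In `f + g δ` the term `f` never produces a `δ`, so `g` evolves by itself: the twist is read off
from the `δ`-part `-(a+1) x₁ + (a-1) x₂` of `∂_a δ`. -/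
theorem nh2Coeff_nh2Diff {p : ℕ} {k : Type u} [Field k] [CharP k p] (a : ZMod p) (ξ : NH2 k) :
    nh2Coeff k (nh2Diff a ξ) = pol2Diff ![-(a + 1), a - 1] (nh2Coeff k ξ) := by
  have h1 : ξ (X 1) = (X 0 + X 1) * ξ 1 - ξ (X 0) := by
    rw [← nh2_map_sym_mul ξ (pol2_sum_mem_sym k), ← map_sub, mul_one, add_sub_cancel_left]
  have h2 : ξ (X 1 * X 0) = X 0 * X 1 * ξ 1 := by
    rw [← nh2_map_sym_mul ξ (pol2_prod_mem_sym k), mul_one, mul_comm]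
  have h3 : ξ (X 0 ^ 2) = (X 0 + X 1) * ξ (X 0) - X 0 * X 1 * ξ 1 := by
    rw [← h2, ← nh2_map_sym_mul ξ (pol2_sum_mem_sym k), ← map_sub]
    congr 1
    ring
  have hd : ∀ f : Pol2 k, pol2Diff ![0, a] f =
      pol2Der k f + ZMod.castHom (dvd_refl p) k a • (X 1 * f) := fun f => by
    rw [pol2Diff_apply, Fin.sum_univ_two, smul_eq_C_mul]
    simp
    ring
  rw [nh2Coeff_apply, nh2Coeff_apply, nh2Diff, nh2DiffOf_apply, nh2DiffOf_apply, hd, hd, hd, hd,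
    pol2Diff_apply, Fin.sum_univ_two, map_add, map_add, nh2_map_smul, nh2_map_smul, pol2Der_X, h3,
    h2, mul_one, h1, Derivation.map_one_eq_zero, map_zero, map_sub, Derivation.leibniz, pol2Der_X]
  simp only [smul_eq_C_mul, smul_eq_mul, Matrix.cons_val_zero, Matrix.cons_val_one, map_neg,
    map_sub, map_add, map_one]
  ring

theorem coeff_nh2Coeff_nh2Diff {p : ℕ} {k : Type u} [Field k] [CharP k p] (a : ZMod p) (n : ℕ)
    (ξ : NH2 k) : coeff (Finsupp.single 0 (n + 1)) (nh2Coeff k (nh2Diff a ξ)) =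
      (n - (ZMod.castHom (dvd_refl p) k a + 1)) * coeff (Finsupp.single 0 n) (nh2Coeff k ξ) := by
  rw [nh2Coeff_nh2Diff]
  have h := LinearMap.congr_fun (pol2Diff_eq (k := k) ![-(a + 1), a - 1]) (nh2Coeff k ξ)
  rw [h, LinearMap.add_apply, coeff_add, coeff_pol2Part_one, coeff_pol2Part_zero, add_zero]
  simp only [Matrix.cons_val_zero, map_neg, map_add, map_one]
  ring

/-- Modulo `x₂` only the first variable acts, by `x₁^l ↦ (l - a - 1) x₁^(l+1)`, starting from the
coefficient `1` of `δ`. -/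
theorem coeff_nh2Coeff_nh2Diff_pow {p : ℕ} {k : Type u} [Field k] [CharP k p] (a : ZMod p)
    (n : ℕ) : coeff (Finsupp.single 0 n) (nh2Coeff k ((nh2Diff a ^ n) (nh2Delta k))) =
      ∏ l ∈ Finset.range n, ((l : k) - (ZMod.castHom (dvd_refl p) k a + 1)) := by
  induction n with
  | zero => simp [nh2Coeff_apply, nh2Delta_one, nh2Delta_X]
  | succ n ih =>
    rw [pow_succ', Module.End.mul_apply, coeff_nh2Coeff_nh2Diff, ih, Finset.prod_range_succ,
      mul_comm]

theorem pol2Gr_eq_zero_of_neg {k : Type u} [Field k] {n : ℤ} (hn : n < 0) {f : Pol2 k}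
    (hf : f ∈ pol2Gr k n) : f = 0 := by
  ext m
  by_contra h
  have := hf h
  rw [weight_two] at this
  omega

theorem exists_eq_C_of_mem_pol2Gr_zero {k : Type u} [Field k] {f : Pol2 k}
    (hf : f ∈ pol2Gr k 0) : ∃ c, f = C c := by
  refine ⟨coeff 0 f, ?_⟩
  ext m
  rw [coeff_C]
  split_ifs with h
  · rw [h]
  · by_contra hm
    have := hf hm
    rw [weight_two] at this
    refine h (Finsupp.ext fun i => ?_)
    fin_cases i <;> simp <;> omega

theorem nh2_eq_zero_of_lt {k : Type u} [Field k] {d : ℤ} (hd : d < -2) {ξ : NH2 k}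
    (h : ξ ∈ nh2Gr k d) : ξ = 0 := by
  obtain ⟨h1, h2⟩ := nh2_mem_coeff h
  rw [nh2_eq ξ, pol2Gr_eq_zero_of_neg (by omega) h1, pol2Gr_eq_zero_of_neg (by omega) h2]
  simp

theorem exists_eq_smul_delta {k : Type u} [Field k] {ξ : NH2 k} (h : ξ ∈ nh2Gr k (-2)) :
    ∃ c : k, ξ = c • nh2Delta k := by
  obtain ⟨h1, h2⟩ := nh2_mem_coeff h
  obtain ⟨c, hc⟩ := exists_eq_C_of_mem_pol2Gr_zero h2
  refine ⟨c, ?_⟩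
  rw [nh2_eq ξ, pol2Gr_eq_zero_of_neg (by omega) h1, hc, map_zero, zero_add, Algebra.smul_def]
  congr 1
  exact nh2Mul.commutes c

theorem nh2Delta_notMem_ideal (k : Type u) [Field k] : nh2Delta k ∉ nh2Ideal k := by
  intro h
  have h1 := congrArg (fun ξ : NH2 k => ξ (X 0)) (nh2Post_aug_ideal 0 h)
  simp [nh2Post_apply_X, nh2Delta_X, pol2Aug_apply, nh2DeltaAt_one] at h1

/-- The element `δ` spans the lowest degree, which leaves no room for a homotopy at its class. Hence
`g` sends this class to a nonzero multiple of `δ`, and commutation of `g` with the differentials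
transports the vanishing to `NH₂`. -/
theorem nh2Diff_pow_delta_eq_zero {p : ℕ} [Fact p.Prime] {k : Type u} [Field k] [CharP k p]
    {a : ZMod p} (hq : (nh2Pi p k a).IsQuasiIso) {n : ℕ} (hn : n ≤ p - 1)
    (h0 : (nh2QuotMap (nh2Diff a) (nh2Diff_mem_ideal a) ^ n)
      (Ideal.Quotient.mkₐ k (nh2Ideal k) (nh2Delta k)) = 0) :
    (nh2Diff a ^ n) (nh2Delta k) = 0 := by
  -- Only the homotopy on the quotient is needed.
  obtain ⟨⟨g, hgm, hgc⟩, -, ⟨h, hh, hs⟩⟩ := hq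
  change NH2Quot k →ₗ[k] NH2 k at g
  change NH2Quot k →ₗ[k] NH2Quot k at h
  change ∀ (d : ℤ) (x : NH2Quot k), x ∈ nh2QuotGr k d → g x ∈ nh2Gr k d at hgm
  change ∀ (d : ℤ) (x : NH2Quot k), x ∈ nh2QuotGr k d → h x ∈ nh2QuotGr k _ at hh
  set D : Module.End k (NH2Quot k) := nh2QuotMap (nh2Diff a) (nh2Diff_mem_ideal a) with hD
  set π := Ideal.Quotient.mkₐ k (nh2Ideal k) with hπ
  change ∀ x : NH2Quot k, g (D x) = nh2Diff a (g x) at hgc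
  change (π.toLinearMap ∘ₗ g : NH2Quot k →ₗ[k] NH2Quot k) -
    (LinearMap.id : NH2Quot k →ₗ[k] NH2Quot k) =
    ∑ j ∈ Finset.range p, (D ^ (p - 1 - j)) ∘ₗ h ∘ₗ (D ^ j) at hs
  have hmem : ∀ j : ℕ, (D ^ j) (π (nh2Delta k)) ∈ nh2QuotGr k (-2 + 2 * (j : ℤ)) := by
    intro j
    induction j with
    | zero => exact ⟨_, nh2Delta_mem k, rfl⟩
    | succ j ih =>
      rw [pow_succ', Module.End.mul_apply]
      have := (nh2QuotPDG p k a).d_mem _ _ ih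
      rw [Nat.cast_succ, mul_add, ← add_assoc]
      exact this
  have hzero : ∑ j ∈ Finset.range p, ((D ^ (p - 1 - j)) ∘ₗ h ∘ₗ (D ^ j)) (π (nh2Delta k)) = 0 := by
    refine Finset.sum_eq_zero fun j hj => ?_
    have hj' := Finset.mem_range.1 hj
    have : h ((D ^ j) (π (nh2Delta k))) = 0 := by
      -- For `j ≥ n` the argument of `h` is already zero. For `j < n ≤ p - 1` the value of `h` has
      -- degree `2j - 2p < -2`, where nothing lives.
      by_cases hjn : n ≤ j
      · rw [Module.End.pow_map_zero_of_le hjn h0, map_zero]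
      · obtain ⟨ξ, hξ, hξ'⟩ := hh _ _ (hmem j)
        rw [← hξ', nh2_eq_zero_of_lt (by omega) hξ, map_zero]
    rw [LinearMap.comp_apply, LinearMap.comp_apply, this, map_zero]
  have hπg : π (g (π (nh2Delta k))) = π (nh2Delta k) := by
    have := LinearMap.congr_fun hs (π (nh2Delta k))
    rw [LinearMap.sum_apply, hzero] at this
    exact sub_eq_zero.1 this
  obtain ⟨c, hc⟩ := exists_eq_smul_delta (hgm (-2) _ ⟨_, nh2Delta_mem k, rfl⟩)
  change g (π (nh2Delta k)) = c • nh2Delta k at hc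
  have hc0 : c ≠ 0 := by
    rintro rfl
    rw [hc, zero_smul, map_zero] at hπg
    exact nh2Delta_notMem_ideal k (Ideal.Quotient.eq_zero_iff_mem.1 hπg.symm)
  have hpow : ∀ (m : ℕ) (x : NH2Quot k), g ((D ^ m) x) = (nh2Diff a ^ m) (g x) := by
    intro m x
    induction m with
    | zero => rfl
    | succ m ih => rw [pow_succ', Module.End.mul_apply, hgc, ih, pow_succ', Module.End.mul_apply]
  have := hpow n (π (nh2Delta k))
  rw [h0, map_zero, hc, map_smul] at this
  exact (smul_eq_zero.1 this.symm).resolve_left hc0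

theorem nh2Diff_one {p : ℕ} {k : Type u} [Field k] [CharP k p] (a : ZMod p) :
    nh2Diff a (1 : NH2 k) = 0 := by
  rw [← map_one nh2Mul, nh2Diff_nh2Mul, Derivation.map_one_eq_zero, map_zero]

theorem end_pow_three_apply_eq_zero {k V : Type*} [Field k] [AddCommGroup V] [Module k V]
    {D : Module.End k V} {e x y z : V} {b c : k} (hz : D z = c • e - b • y) (hy : D y = c • x)
    (he : D e = 0) (hx : D x = 0) : (D ^ 3) z = 0 := by
  simp [pow_succ', hz, hy, he, hx]

/-- In the quotient `x₂ = -x₁` and `x₁² = 0`, so `∂δ = a - 2a x₁δ`, `∂(x₁δ) = a x₁` and `∂x₁ = 0`.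
-/
theorem nh2QuotMap_pow_delta {p : ℕ} [Fact p.Prime] {k : Type u} [Field k] [CharP k p]
    (a : ZMod p) :
    (nh2QuotMap (nh2Diff a) (nh2Diff_mem_ideal a) ^ 3)
      (Ideal.Quotient.mkₐ k (nh2Ideal k) (nh2Delta k)) = 0 ∧
    (a = 0 → (nh2QuotMap (nh2Diff a) (nh2Diff_mem_ideal a) ^ 1)
      (Ideal.Quotient.mkₐ k (nh2Ideal k) (nh2Delta k)) = 0) := by
  set D : Module.End k (NH2Quot k) := nh2QuotMap (nh2Diff a) (nh2Diff_mem_ideal a) with hD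
  set π := Ideal.Quotient.mkₐ k (nh2Ideal k) with hπ
  set c := ZMod.castHom (dvd_refl p) k a with hc
  have hDπ : ∀ ξ, D (π ξ) = π (nh2Diff a ξ) := fun _ => rfl
  have hs : ∀ e ∈ sym2Aug k, π (nh2Mul e) = 0 := fun e he =>
    Ideal.Quotient.eq_zero_iff_mem.2 (Ideal.subset_span ⟨e, he, rfl⟩)
  have hy : π (nh2Mul (X 1)) = -π (nh2Mul (X 0)) := by
    have := hs (X 0 + X 1) ⟨pol2_sum_mem_sym k, by simp⟩
    rw [map_add, map_add] at this
    exact eq_neg_of_add_eq_zero_right this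
  have hxx : π (nh2Mul (X 0)) * π (nh2Mul (X 0)) = 0 := by
    have := hs (X 0 * X 1) ⟨pol2_prod_mem_sym k, by simp⟩
    rw [map_mul, map_mul, hy, mul_neg, neg_eq_zero] at this
    exact this
  have hdx : D (π (nh2Mul (X 0))) = 0 := by
    rw [hDπ, (nh2Diff_generators a).1, pow_two, map_mul, hxx]
  have hd : D (π (nh2Delta k)) = c • 1 - (2 * c) • (π (nh2Mul (X 0)) * π (nh2Delta k)) := by
    rw [hDπ, (nh2Diff_generators a).2, map_add, map_sub, map_smul, map_smul, map_mul, map_mul, hy,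
      neg_mul, AlgHom.commutes, Algebra.algebraMap_eq_smul_one, ← hc]
    module
  have hdxd : D (π (nh2Mul (X 0)) * π (nh2Delta k)) = c • π (nh2Mul (X 0)) := by
    have h1 : D (π (nh2Mul (X 0)) * π (nh2Delta k)) =
        D (π (nh2Mul (X 0))) * π (nh2Delta k) + π (nh2Mul (X 0)) * D (π (nh2Delta k)) :=
      (nh2QuotPDG p k a).leibniz _ _
    rw [h1, hdx, hd, zero_mul, zero_add, mul_sub, mul_smul_comm, mul_one, mul_smul_comm,
      ← mul_assoc, hxx, zero_mul, smul_zero, sub_zero]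
  have h1 : D 1 = 0 := by
    rw [← map_one π, hDπ, nh2Diff_one, map_zero]
  refine ⟨?_, fun ha => ?_⟩
  · exact end_pow_three_apply_eq_zero hd hdxd h1 hdx
  · have : c = 0 := by rw [hc, ha, map_zero]
    rw [pow_one, hd, this, mul_zero, zero_smul, zero_smul, sub_zero]

theorem zmod_two_eq_one_or : ∀ a : ZMod 2, a ≠ 0 → a = 1 ∨ a = -1 := by decide

theorem zmod_three_eq_one_or : ∀ a : ZMod 3, a ≠ 0 → a = 1 ∨ a = -1 := by decide

theorem eq_one_or_of_nh2Pi_isQuasiIso {p : ℕ} [Fact p.Prime] {k : Type u} [Field k] [CharP k p]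
    {a : ZMod p} (hq : (nh2Pi p k a).IsQuasiIso) : a = 1 ∨ a = -1 := by
  have hp := (Fact.out (p := p.Prime)).two_le
  have hinj : Function.Injective (ZMod.castHom (dvd_refl p) k) := RingHom.injective _
  have key : ∀ n : ℕ, n ≤ p - 1 → (nh2QuotMap (nh2Diff a) (nh2Diff_mem_ideal a) ^ n)
      (Ideal.Quotient.mkₐ k (nh2Ideal k) (nh2Delta k)) = 0 →
        ∃ l < n, (l : ZMod p) = a + 1 := by
    intro n hn h0
    have h := coeff_nh2Coeff_nh2Diff_pow (k := k) a n
    rw [nh2Diff_pow_delta_eq_zero hq hn h0, map_zero, coeff_zero] at h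
    obtain ⟨l, hl, hl'⟩ := Finset.prod_eq_zero_iff.1 h.symm
    refine ⟨l, Finset.mem_range.1 hl, hinj ?_⟩
    rw [map_natCast, map_add, map_one]
    exact sub_eq_zero.1 hl'
  obtain ⟨h3, h1⟩ := nh2QuotMap_pow_delta (k := k) a
  by_cases ha : a = 0
  · obtain ⟨l, hl, h⟩ := key 1 (by omega) (h1 ha)
    obtain rfl : l = 0 := by omega
    right
    linear_combination -h
  -- The bound `n ≤ p - 1` with `n = 3` needs `p ≥ 5`; the primes `2` and `3` are settled by
  -- inspection.
  · by_cases hp5 : 3 ≤ p - 1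
    · obtain ⟨l, hl, h⟩ := key 3 hp5 h3
      interval_cases l
      · right
        linear_combination -h
      · exact absurd (by linear_combination -h) ha
      · left
        linear_combination -h
    · obtain rfl | rfl : p = 2 ∨ p = 3 := by omega
      · exact zmod_two_eq_one_or a ha
      · exact zmod_three_eq_one_or a ha

end Obstruction

theorem mainTheorem6 (p : ℕ) [Fact p.Prime] (k : Type u) [Field k] [CharP k p] (a : ZMod p) :
    Nonempty (NH2Quot k ≃ₐ[k] Matrix (Fin 2) (Fin 2) k) ∧
      ((nh2Pi p k a).IsQuasiIso ↔ a = 1 ∨ a = -1) := by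
  refine ⟨nonempty_nh2Quot_algEquiv_matrix k, eq_one_or_of_nh2Pi_isQuasiIso, ?_⟩
  rintro (rfl | rfl)
  -- The twists `α = (-1, 0)` and `α = (0, -1)` have `α₂ - α₁` equal to `1` and `-1` respectively.
  · exact nh2Pi_isQuasiIso_of_eq (i := 0) (j := 1) (by decide) (by rw [nh2DiffOf_eq]; simp)
  · exact nh2Pi_isQuasiIso_of_eq (i := 1) (j := 0) (by decide) (by rw [nh2DiffOf_eq]; simp)
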